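/- Theorem (two-dimensional Gross–Pitaevskii equation, resonant case). For $j\in\mathbb Z^2$ and $t\in K=[0,1)^2$ put $\vec P_j(t)=j+t$ and $p_j^2(t)=|\vec P_j(t)|^2$. For a $2\pi\mathbb Z^2$-periodic function $f$ with Fourier coefficients $f_m$ ($m\in\mathbb Z^2$) put $\|f\|_*=\sum_m|f_m|$. For $q\in\mathbb Z^2$, $k>0$, $\epsilon>0$ let $\chi_q(k,\epsilon)$ be the set of all $t\in K$ for which there is an index $j\in\mathbb Z^2$ with (1) $|\vec P_j(t)|=k$, (2) $|p_{j-q}^2(t)-p_j^2(t)|<\epsilon$, (3) $|p_j^2(t)-p_m^2(t)|>2\epsilon^6$ for all $m\ne j,\,j-q$. There are absolute constants $\epsilon_0>0$ and $C>0$ such that the following holds for every $0<\epsilon<\epsilon_0$. Let $V(x)=\sum_q v_qe^{i\langle q,x\rangle}$ be a real-valued trigonometric polynomial on $\mathbb R^2$ with $v_0=0$ and $\|V\|_*<\epsilon^9$. There is $k_1=k_1(V,\epsilon)$ such that for all $k>k_1$, all $q\in\mathbb Z^2$ with $|v_q|>\epsilon^{10}$, and all $\sigma\in\mathbb R$, $A\in\mathbb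 C$ with $|\sigma||A|^2<\epsilon^{11}$: let $t_0\in\chi_q(k,\epsilon)$ with $j$ satisfying (1)–(3) for $t_0$, and let $t\in K$ with $|t-t_0|<k^{-1}\epsilon^7$. Let $$\hat\lambda^+(t)=\tfrac12\big(p_j^2(t)+p_{j-q}^2(t)\big)+\tfrac12\sqrt{4|v_q|^2+(p_j^2(t)-p_{j-q}^2(t))^2}$$ be the larger eigenvalue of $\begin{pmatrix}p_j^2(t)&v_q\\ v_{-q}&p_{j-q}^2(t)\end{pmatrix}$, let $\hat E^+(t)$ be the orthogonal projection onto its eigenspace (rows and columns labelled by $j$, $j-q$), and let $\psi_{-1}(x)=\hat E^+_{j,j}+\hat E^+_{j-q,j}e^{-i\langle q,x\rangle}$. Then there are $\lambda\in\mathbb R$ and $u\in C^2(\mathbb R^2;\mathbb C)$ with $$-\Delta u+Vu+\sigma|u|^2u=\lambda u\quad\text{on }\mathbb R^2,$$ satisfying the quasi-periodic conditions $u(x+2\pi e_s)=e^{2\pi it_s}u(x)$, $\partial_su(x+2\pi e_s)=e^{2\pi it_s}\partial_su(x)$ ($s=1,2$), such that $$u(x)=Ae^{i\langle\vec P_j(t),x\rangle}\big(\psi_{-1}(x)+\hat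 u(x)\big),\qquad |\lambda-\hat\lambda^+(t)|\le C\epsilon^{11},$$ where $\hat u$ is continuous, $2\pi\mathbb Z^2$-periodic and $\|\hat u\|_*\le\epsilon$. Moreover, if $A\neq0$ and $2|p_m^2(t)-\hat\lambda^+(t)|\ge\epsilon^6$ for all $m\ne j,j-q$, then $u$ is not identically zero. -/

import Mathlib

open MeasureTheory
open scoped ENNReal

noncomputable section

namespace GrossPitaevskii

/-- The Euclidean plane. -/
abbrev Plane : Type := EuclideanSpace ℝ (Fin 2)

/-- The lattice `ℤ²` of indices. -/
abbrev Idx : Type := Fin 2 → ℤ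

/-- The lattice point `m ∈ ℤ²` as a vector of the plane. -/
def latticeVec (m : Idx) : Plane := WithLp.toLp 2 (fun s => (m s : ℝ))

/-- `P_j(t) = j + t`. -/
def P (j : Idx) (t : Plane) : Plane := latticeVec j + t

/-- The free eigenvalue `p_j²(t) = |P_j(t)|²`. -/
def pSq (j : Idx) (t : Plane) : ℝ := ‖P j t‖ ^ 2

/-- The plane wave `x ↦ e^{i⟨ξ, x⟩}`. -/
def planeWave (ξ x : Plane) : ℂ := Complex.exp (Complex.I * ((inner ℝ ξ x : ℝ) : ℂ))

/-- The elementary cell `K = [0,1)²` of quasimomenta. -/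
def dualCell : Set Plane := {t | ∀ s, t s ∈ Set.Ico (0 : ℝ) 1}

/-- The elementary cell of periods `Q = [0,2π]²`. -/
def periodCell : Set Plane := {x | ∀ s, x s ∈ Set.Icc (0 : ℝ) (2 * Real.pi)}

/-- The translation vector `2π e_s`. -/
def period (s : Fin 2) : Plane := EuclideanSpace.single s (2 * Real.pi)

/-- `f` has period `2π` in each coordinate. -/
def IsPeriodic (f : Plane → ℂ) : Prop := ∀ x s, f (x + period s) = f x

/-- The partial derivative `∂f/∂x_s`. -/
def partialDeriv (s : Fin 2) (f : Plane → ℂ) (x : Plane) : ℂ :=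
  fderiv ℝ f x (EuclideanSpace.single s 1)

/-- The quasi-periodic conditions with quasimomentum `t`, on the function and on its
first normal derivatives. -/
def IsQuasiPeriodic (t : Plane) (u : Plane → ℂ) : Prop :=
  ∀ x s,
    u (x + period s) = Complex.exp (2 * Real.pi * Complex.I * (t s : ℂ)) * u x ∧
    partialDeriv s u (x + period s) =
      Complex.exp (2 * Real.pi * Complex.I * (t s : ℂ)) * partialDeriv s u x

/-- The Fourier coefficient `(2π)⁻² ∫_Q f(x) e^{-i⟨m, x⟩} dx`. -/
def fourierCoef (f : Plane → ℂ) (m : Idx) : ℂ :=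
  (1 / (2 * Real.pi) ^ 2 : ℂ) * ∫ x in periodCell, f x * planeWave (-latticeVec m) x

/-- The norm `‖f‖_* = ∑_m |f_m|`, with value `∞` if the series diverges. -/
def starNorm (f : Plane → ℂ) : ℝ≥0∞ := ∑' m : Idx, ‖fourierCoef f m‖ₑ

/-- The trigonometric polynomial `V(x) = ∑_q v_q e^{i⟨q, x⟩}`. -/
def trigPoly (v : Idx →₀ ℂ) (x : Plane) : ℂ := v.sum fun q c => c * planeWave (latticeVec q) x

/-- The coefficients of a real trigonometric polynomial of mean zero. -/
structure IsRealMeanZero (v : Idx →₀ ℂ) : Prop where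
  real : ∀ q, v (-q) = (starRingEnd ℂ) (v q)
  mean_zero : v 0 = 0

/-- `P_j(t)` lies on the circle of radius `k`, `p_j²(t)` and `p_{j-q}²(t)` are `ε`-close, and
all the other free eigenvalues are farther than `2ε⁶` from `p_j²(t)`. -/
structure IsResonantIndex (q : Idx) (k ε : ℝ) (t : Plane) (j : Idx) : Prop where
  on_circle : ‖P j t‖ = k
  close : |pSq (j - q) t - pSq j t| < ε
  separated : ∀ m, m ≠ j → m ≠ j - q → 2 * ε ^ 6 < |pSq j t - pSq m t|

/-- The resonant set `χ_q(k, ε)`: all quasimomenta in `K` that have a resonant index. -/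
def resonantSet (q : Idx) (k ε : ℝ) : Set Plane :=
  {t | t ∈ dualCell ∧ ∃ j, IsResonantIndex q k ε t j}

/-- The upper eigenvalue `λ̂⁺(t)` of the model matrix
`((p_j²(t), v_q), (v_{-q}, p_{j-q}²(t)))`. -/
def lambdaPlus (v : Idx →₀ ℂ) (q j : Idx) (t : Plane) : ℝ :=
  (pSq j t + pSq (j - q) t) / 2 +
    Real.sqrt (4 * ‖v q‖ ^ 2 + (pSq j t - pSq (j - q) t) ^ 2) / 2

/-- The eigenvector of the model matrix for `λ̂⁺(t)`; its components correspond to the indices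
`j` and `j - q`. -/
def ePlus (v : Idx →₀ ℂ) (q j : Idx) (t : Plane) : Fin 2 → ℂ :=
  ![((pSq (j - q) t - lambdaPlus v q j t : ℝ) : ℂ), -v (-q)]

/-- The spectral projection `Ê⁺(t)`, that is, the orthogonal projection onto the line spanned by
the eigenvector. -/
def projPlus (v : Idx →₀ ℂ) (q j : Idx) (t : Plane) : Matrix (Fin 2) (Fin 2) ℂ :=
  (1 / ((∑ i, ‖ePlus v q j t i‖ ^ 2 : ℝ) : ℂ)) •
    Matrix.vecMulVec (ePlus v q j t) (star (ePlus v q j t))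

/-- `ψ_{-1}(x) = Ê⁺_{j,j} + Ê⁺_{j-q,j} e^{-i⟨q, x⟩}`. -/
def psi (v : Idx →₀ ℂ) (q j : Idx) (t x : Plane) : ℂ :=
  projPlus v q j t 0 0 + projPlus v q j t 1 0 * planeWave (-latticeVec q) x

/-- `u` is a classical solution of `-Δu + Vu + σ|u|²u = lam u` on the plane. -/
def IsSolution (V : Plane → ℂ) (σ lam : ℝ) (u : Plane → ℂ) : Prop :=
  ContDiff ℝ 2 u ∧
    ∀ x, -(Laplacian.laplacian u x) + V x * u x + σ * (‖u x‖ : ℂ) ^ 2 * u x = lam * u x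

end GrossPitaevskii

end

open GrossPitaevskii

/-!
The coefficients `f` of `u = B e^{i⟨P_j(t), x⟩} ∑ f_m e^{i⟨m, x⟩}` solve a system in `ℓ¹(ℤ²)`,
a Banach algebra under convolution, in which the free operator is diagonal with entries
`p_{j+m}²(t)`. Put `f = (a, b) + β (-b̄, ā) + (ε/8) g`, where `(a, b)` is the unit eigenvector
of the block at the indices `0` and `-q`, and `g` vanishes there. The component of the equation
along `(a, b)` gives the shift of the eigenvalue, the one along `(-b̄, ā)` gives `β` after division
by the gap of the block, which is at least `2ε¹⁰`, and the remaining ones give `g` after division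
by `p_{j+m}²(t) - λ̂⁺(t)`, which is at least `ε⁶/2` in absolute value. The resulting map is a
contraction of a ball of radius `ε/2`. Its fixed point solves the system, and the eigenvalue is
real because `-Δ + V + σ|u|²` is symmetric.

If some `p_{j+m}²(t)` off the block is closer than `ε⁶/2` to `λ̂⁺(t)`, then `p_j²(t)` is not
close to it, the leading term `ψ₋₁` is of order `ε³`, and `u = 0` satisfies all the requirements.
-/

open scoped BoundedContinuousFunction

noncomputable section

namespace GrossPitaevskii

/-- The algebra `ℓ¹(G)` under convolution and the involution `f*(m) = conj f(-m)`; for `G = ℤ²` it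
consists of the Fourier coefficients of absolutely convergent Fourier series on the torus. It is a
synonym of `lp`, which carries the pointwise involution. -/
def WienerAlgebra (G : Type*) : Type _ := lp (fun _ : G => ℂ) 1

namespace WienerAlgebra

variable {G : Type*}

instance : NormedAddCommGroup (WienerAlgebra G) :=
  inferInstanceAs (NormedAddCommGroup (lp (fun _ : G => ℂ) 1))

instance : NormedSpace ℂ (WienerAlgebra G) :=
  inferInstanceAs (NormedSpace ℂ (lp (fun _ : G => ℂ) 1))

instance : CompleteSpace (WienerAlgebra G) :=
  inferInstanceAs (CompleteSpace (lp (fun _ : G => ℂ) 1))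

instance : FunLike (WienerAlgebra G) G ℂ where
  coe := fun f : lp (fun _ : G => ℂ) 1 => ⇑f
  coe_injective _ _ h := lp.ext h

@[ext]
theorem ext {f g : WienerAlgebra G} (h : ∀ m, f m = g m) : f = g := DFunLike.ext f g h

@[simp]
theorem add_apply (f g : WienerAlgebra G) (m : G) : (f + g) m = f m + g m := rfl

@[simp]
theorem sub_apply (f g : WienerAlgebra G) (m : G) : (f - g) m = f m - g m := rfl

@[simp]
theorem neg_apply (f : WienerAlgebra G) (m : G) : (-f) m = -f m := rfl

@[simp]
theorem zero_apply (m : G) : (0 : WienerAlgebra G) m = 0 := rfl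

@[simp]
theorem smul_apply (c : ℂ) (f : WienerAlgebra G) (m : G) : (c • f) m = c * f m := rfl

theorem summable_norm (f : WienerAlgebra G) : Summable fun m => ‖f m‖ := by
  have h : Summable fun m => ‖f m‖ ^ (1 : ℝ≥0∞).toReal := (lp.memℓp f).summable (by simp)
  simpa using h

theorem norm_eq_tsum (f : WienerAlgebra G) : ‖f‖ = ∑' m, ‖f m‖ := by
  have h : ‖f‖ = (∑' m, ‖f m‖ ^ (1 : ℝ≥0∞).toReal) ^ (1 / (1 : ℝ≥0∞).toReal) :=
    lp.norm_eq_tsum_rpow (by simp) f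
  simpa using h

theorem norm_apply_le (f : WienerAlgebra G) (m : G) : ‖f m‖ ≤ ‖f‖ :=
  lp.norm_apply_le_norm one_ne_zero f m

/-- The coefficient at `m`, as a continuous linear functional. -/
def coeff (m : G) : WienerAlgebra G →L[ℂ] ℂ := lp.evalCLM ℂ (fun _ : G => ℂ) 1 m

@[simp]
theorem coeff_apply (m : G) (f : WienerAlgebra G) : coeff m f = f m := rfl

/-- A finitely supported family of coefficients. -/
def ofFinsupp (v : G →₀ ℂ) : WienerAlgebra G :=
  ⟨fun m => v m, memℓp_gen <| summable_of_ne_finset_zero (s := v.support) fun m hm => by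
    simp [Finsupp.notMem_support_iff.mp hm]⟩

@[simp]
theorem ofFinsupp_apply (v : G →₀ ℂ) (m : G) : ofFinsupp v m = v m := rfl

section Lift

variable {E : Type*} [NormedAddCommGroup E] [NormedSpace ℂ E] [CompleteSpace E]

/-- The continuous linear map `f ↦ ∑ f_n x_n` attached to a bounded family `x`. -/
def lift (x : G → E) {C : ℝ} (hC : 0 ≤ C) (hx : ∀ n, ‖x n‖ ≤ C) : WienerAlgebra G →L[ℂ] E :=
  lp.tsumCLM ℂ G E ∘L lp.mapCLM 1 (fun n => ContinuousLinearMap.toSpanSingleton ℂ (x n)) hC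
    fun n => (ContinuousLinearMap.norm_toSpanSingleton (x n)).trans_le (hx n)

theorem lift_apply (x : G → E) {C : ℝ} (hC : 0 ≤ C) (hx : ∀ n, ‖x n‖ ≤ C)
    (f : WienerAlgebra G) : lift x hC hx f = ∑' n, f n • x n := rfl

theorem norm_lift_le (x : G → E) {C : ℝ} (hC : 0 ≤ C) (hx : ∀ n, ‖x n‖ ≤ C) :
    ‖lift x hC hx‖ ≤ C :=
  (ContinuousLinearMap.opNorm_comp_le _ _).trans <|
    (mul_le_mul lp.norm_tsumCLM_le (lp.norm_mapCLM_le _ _ _ _) (norm_nonneg _)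
      zero_le_one).trans_eq (one_mul C)

theorem summable_smul {x : G → E} {C : ℝ} (hx : ∀ n, ‖x n‖ ≤ C) (f : WienerAlgebra G) :
    Summable fun n => f n • x n :=
  .of_norm_bounded (f.summable_norm.mul_right C) fun n => by
    rw [norm_smul]
    exact mul_le_mul_of_nonneg_left (hx n) (norm_nonneg _)

end Lift

section Single

open Classical in
/-- The element with the single coefficient `c` at `m`. -/
def single (m : G) (c : ℂ) : WienerAlgebra G := lp.single 1 m c

open Classical in
theorem single_apply (m n : G) (c : ℂ) : single m c n = if n = m then c else 0 := by
  refine (lp.single_apply (E := fun _ : G => ℂ) 1 m c n).trans ?_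
  split_ifs <;> simp_all

@[simp]
theorem single_apply_self (m : G) (c : ℂ) : single m c m = c := by rw [single_apply, if_pos rfl]

theorem single_apply_of_ne {m n : G} (h : n ≠ m) (c : ℂ) : single m c n = 0 := by
  rw [single_apply, if_neg h]

@[simp]
theorem norm_single (m : G) (c : ℂ) : ‖single m c‖ = ‖c‖ := by
  classical exact lp.norm_single (E := fun _ : G => ℂ) (p := 1) zero_lt_one m c

theorem smul_single (m : G) (c d : ℂ) : c • single m d = single m (c * d) := by
  classical exact (lp.single_smul (E := fun _ : G => ℂ) 1 m c d).symm

theorem clm_ext {E : Type*} [AddCommMonoid E] [Module ℂ E] [TopologicalSpace E] [T2Space E]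
    {S T : WienerAlgebra G →L[ℂ] E}
    (h : ∀ m, S (single m 1) = T (single m 1)) : S = T := by
  classical
  exact lp.ext_continuousLinearMap ENNReal.one_ne_top fun m => ContinuousLinearMap.ext_ring (h m)

theorem lift_single {E : Type*} [NormedAddCommGroup E] [NormedSpace ℂ E] [CompleteSpace E]
    (x : G → E) {C : ℝ} (hC : 0 ≤ C) (hx : ∀ n, ‖x n‖ ≤ C) (m : G) (c : ℂ) :
    lift x hC hx (single m c) = c • x m := by
  rw [lift_apply, tsum_eq_single m fun n hn => by rw [single_apply_of_ne hn, zero_smul],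
    single_apply_self]

end Single

section Ring

variable [AddCommGroup G]

/-- The bilinear map underlying the product, determined by `δ_m * δ_n = δ_{m+n}`. -/
def convolution : WienerAlgebra G →L[ℂ] WienerAlgebra G →L[ℂ] WienerAlgebra G :=
  lift (fun m => lift (fun n => single (m + n) 1) zero_le_one fun _ => by simp) zero_le_one
    fun _ => norm_lift_le _ _ _

instance : Mul (WienerAlgebra G) := ⟨fun f g => convolution f g⟩

instance : One (WienerAlgebra G) := ⟨single 0 1⟩

theorem one_def : (1 : WienerAlgebra G) = single 0 1 := rfl

theorem convolution_apply (f g : WienerAlgebra G) : convolution f g = f * g := rfl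

theorem single_mul_single (m n : G) (c d : ℂ) :
    single m c * single n d = single (m + n) (c * d) := by
  rw [← convolution_apply, convolution, lift_single, _root_.smul_apply, lift_single, smul_single,
    smul_single, mul_one]

protected theorem mul_comm (f g : WienerAlgebra G) : f * g = g * f := by
  have h : convolution (G := G) = convolution.flip := clm_ext fun m => clm_ext fun n => by
    simp only [ContinuousLinearMap.flip_apply, convolution_apply, single_mul_single, add_comm m n]
  exact congr($h f g)

protected theorem mul_assoc (f g h : WienerAlgebra G) : f * g * h = f * (g * h) := by
  have h₁ (k l : G) : convolution (single k 1 * single l 1)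
      = convolution (single k 1) ∘L convolution (single l 1) := clm_ext fun m => by
    simp only [ContinuousLinearMap.comp_apply, convolution_apply, single_mul_single, add_assoc,
      mul_one]
  have h₂ (k : G) : convolution.flip h ∘L convolution (single k 1)
      = convolution (single k 1) ∘L convolution.flip h := clm_ext fun l => congr($(h₁ k l) h)
  have h₃ : convolution.flip h ∘L convolution.flip g = convolution.flip (g * h) :=
    clm_ext fun k => congr($(h₂ k) g)
  exact congr($h₃ f)

instance : NormedCommRing (WienerAlgebra G) where
  __ := (inferInstance : NormedAddCommGroup (WienerAlgebra G))
  mul_assoc := WienerAlgebra.mul_assoc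
  mul_comm := WienerAlgebra.mul_comm
  left_distrib f g h := map_add (convolution f) g h
  right_distrib f g h := map_add (convolution.flip h) f g
  zero_mul f := map_zero (convolution.flip f)
  mul_zero f := map_zero (convolution f)
  one_mul f := by
    have h : convolution (1 : WienerAlgebra G) = .id ℂ _ := clm_ext fun m => by
      rw [convolution_apply, one_def, single_mul_single, zero_add, one_mul,
        ContinuousLinearMap.id_apply]
    exact congr($h f)
  mul_one f := by
    have h : convolution.flip (1 : WienerAlgebra G) = .id ℂ _ := clm_ext fun m => by
      rw [ContinuousLinearMap.flip_apply, convolution_apply, one_def, single_mul_single, add_zero,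
        one_mul, ContinuousLinearMap.id_apply]
    exact congr($h f)
  norm_mul_le f g := by
    have h : ‖convolution (G := G)‖ ≤ 1 := norm_lift_le _ _ _
    exact (convolution.le_of_opNorm₂_le_of_le h le_rfl le_rfl).trans_eq (by rw [one_mul])

instance : NormedAlgebra ℂ (WienerAlgebra G) where
  __ := Algebra.ofModule (fun c f g => (map_smul (convolution.flip g) c f))
    fun c f g => map_smul (convolution f) c g
  norm_smul_le := norm_smul_le

theorem mul_apply (f g : WienerAlgebra G) (m : G) : (f * g) m = ∑' n, f n * g (m - n) := by
  have hf (k : G) : coeff m ∘L convolution (single k 1) = coeff (m - k) := clm_ext fun l => by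
    classical
    simp only [ContinuousLinearMap.comp_apply, convolution_apply, single_mul_single, coeff_apply,
      single_apply, sub_eq_iff_eq_add, add_comm k l, mul_one]
  have h : coeff m ∘L convolution.flip g
      = lift (fun n => g (m - n)) (norm_nonneg g) fun n => norm_apply_le g _ := clm_ext fun k => by
    rw [lift_single, one_smul]
    exact congr($(hf k) g)
  exact congr($h f)

theorem mul_single_apply (f : WienerAlgebra G) (n m : G) (c : ℂ) :
    (f * single n c) m = f (m - n) * c := by
  rw [mul_apply, tsum_eq_single (m - n), sub_sub_cancel, single_apply_self]
  intro k hk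
  rw [single_apply_of_ne, mul_zero]
  contrapose! hk
  rw [← hk, sub_sub_cancel]

instance : Star (WienerAlgebra G) where
  star f := ⟨fun m => star (f (-m)), memℓp_gen <| by
    simpa [Function.comp_def] using (Equiv.neg G).summable_iff.mpr f.summable_norm⟩

@[simp]
theorem star_apply (f : WienerAlgebra G) (m : G) : star f m = star (f (-m)) := rfl

theorem star_single (m : G) (c : ℂ) : star (single m c) = single (-m) (star c) := by
  ext n
  by_cases h : n = -m
  · rw [star_apply, h, neg_neg, single_apply_self, single_apply_self]
  · rw [star_apply, single_apply_of_ne h, single_apply_of_ne fun h' => h (neg_eq_iff_eq_neg.mp h'),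
      star_zero]

instance : StarRing (WienerAlgebra G) where
  star_involutive f := by
    ext m
    simp
  star_add f g := by
    ext m
    simp
  star_mul f g := by
    ext m
    rw [mul_comm, star_apply, mul_apply, mul_apply, tsum_star, ← (Equiv.neg G).tsum_eq]
    refine tsum_congr fun n => ?_
    rw [star_mul', star_apply, star_apply, Equiv.neg_apply, neg_sub', sub_neg_eq_add]

instance : StarModule ℂ (WienerAlgebra G) where
  star_smul c f := by
    ext m
    simp

instance : NormedStarGroup (WienerAlgebra G) where
  norm_star_le f := by
    rw [norm_eq_tsum, norm_eq_tsum, ← (Equiv.neg G).tsum_eq]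
    exact (tsum_congr fun m => by simp).le

/-- The coefficients of `|F|² F`, where `F` has coefficients `f`. -/
def cubic (f : WienerAlgebra G) : WienerAlgebra G := f * f * star f

theorem norm_cubic_le (f : WienerAlgebra G) : ‖cubic f‖ ≤ ‖f‖ ^ 3 := by
  refine (norm_mul₃_le).trans_eq ?_
  rw [norm_star]
  ring

theorem norm_cubic_sub_le {f g : WienerAlgebra G} {M : ℝ} (hf : ‖f‖ ≤ M) (hg : ‖g‖ ≤ M) :
    ‖cubic f - cubic g‖ ≤ 3 * M ^ 2 * ‖f - g‖ := by
  have hM : 0 ≤ M := (norm_nonneg f).trans hf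
  have h : cubic f - cubic g
      = (f - g) * f * star f + g * (f - g) * star f + g * g * star (f - g) := by
    rw [cubic, cubic, star_sub]
    ring
  calc ‖cubic f - cubic g‖
      ≤ ‖f - g‖ * ‖f‖ * ‖f‖ + ‖g‖ * ‖f - g‖ * ‖f‖ + ‖g‖ * ‖g‖ * ‖f - g‖ := by
        rw [h]
        refine norm_add₃_le.trans (add_le_add_three ?_ ?_ ?_) <;>
          exact norm_mul₃_le.trans_eq (by rw [norm_star])
    _ ≤ ‖f - g‖ * M * M + M * ‖f - g‖ * M + M * M * ‖f - g‖ := by gcongr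
    _ = 3 * M ^ 2 * ‖f - g‖ := by ring

end Ring

end WienerAlgebra

section PlaneWaves

theorem norm_planeWave (ξ x : Plane) : ‖planeWave ξ x‖ = 1 := by
  rw [planeWave, mul_comm]
  exact Complex.norm_exp_ofReal_mul_I _

theorem planeWave_add (ξ η x : Plane) :
    planeWave (ξ + η) x = planeWave ξ x * planeWave η x := by
  simp only [planeWave, inner_add_left, Complex.ofReal_add, mul_add, Complex.exp_add]

theorem planeWave_neg (ξ x : Plane) : planeWave (-ξ) x = star (planeWave ξ x) := by
  simp [planeWave, ← Complex.exp_conj]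

theorem continuous_planeWave (ξ : Plane) : Continuous (planeWave ξ) := by
  unfold planeWave
  fun_prop

theorem planeWave_add_period (ξ x : Plane) (s : Fin 2) :
    planeWave ξ (x + period s)
      = Complex.exp (2 * Real.pi * Complex.I * (ξ s : ℂ)) * planeWave ξ x := by
  rw [planeWave, planeWave, ← Complex.exp_add, inner_add_right, period,
    EuclideanSpace.inner_single_right]
  congr 1
  simp only [Complex.ofReal_add, Complex.ofReal_mul, Complex.ofReal_ofNat, conj_trivial]
  ring

theorem latticeVec_add (m n : Idx) : latticeVec (m + n) = latticeVec m + latticeVec n := by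
  ext s
  simp [latticeVec]

theorem latticeVec_neg (m : Idx) : latticeVec (-m) = -latticeVec m := by
  ext s
  simp [latticeVec]

theorem planeWave_latticeVec (m : Idx) (x : Plane) :
    planeWave (latticeVec m) x = ∏ s, Complex.exp (Complex.I * m s * x s) := by
  rw [planeWave, ← Complex.exp_sum]
  congr 1
  simp [latticeVec, PiLp.inner_apply, Fin.sum_univ_two]
  ring

theorem isPeriodic_planeWave_latticeVec (m : Idx) : IsPeriodic (planeWave (latticeVec m)) := by
  intro x s
  have h : Complex.exp (2 * Real.pi * Complex.I * (latticeVec m s : ℂ)) = 1 :=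
    Complex.exp_eq_one_iff.mpr ⟨m s, by simp [latticeVec, mul_comm]⟩
  rw [planeWave_add_period, h, one_mul]

theorem integral_exp_int_mul (n : ℤ) :
    ∫ y in Set.Icc (0 : ℝ) (2 * Real.pi), Complex.exp (Complex.I * n * y)
      = if n = 0 then (2 * Real.pi : ℂ) else 0 := by
  rw [integral_Icc_eq_integral_Ioc, ← intervalIntegral.integral_of_le (by positivity)]
  split_ifs with hn
  · simp [hn]
  · have h : Complex.exp (Complex.I * n * ((2 * Real.pi : ℝ) : ℂ)) = 1 :=
      Complex.exp_eq_one_iff.mpr ⟨n, by push_cast; ring⟩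
    rw [integral_exp_mul_complex (by simp [hn]), h]
    simp

theorem periodCell_eq_preimage :
    periodCell = (WithLp.ofLp : Plane → Fin 2 → ℝ) ⁻¹'
      Set.univ.pi fun _ => Set.Icc (0 : ℝ) (2 * Real.pi) := by
  ext x
  simp only [periodCell, Set.mem_ofPred_eq, Set.mem_preimage, Set.mem_univ_pi]

theorem volume_periodCell_lt_top : volume periodCell < ∞ := by
  rw [periodCell_eq_preimage, (PiLp.volume_preserving_ofLp (Fin 2)).measure_preimage
    (MeasurableSet.univ_pi fun _ => measurableSet_Icc).nullMeasurableSet, volume_pi_pi]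
  simp [ENNReal.mul_lt_top]

instance : IsFiniteMeasure (volume.restrict periodCell) :=
  ⟨by simpa using volume_periodCell_lt_top⟩

theorem integral_periodCell_prod (f : Fin 2 → ℝ → ℂ) :
    ∫ x in periodCell, ∏ s, f s (x s) = ∏ s, ∫ y in Set.Icc (0 : ℝ) (2 * Real.pi), f s y := by
  have he : MeasurableEmbedding (WithLp.ofLp : Plane → Fin 2 → ℝ) :=
    (MeasurableEquiv.toLp 2 (Fin 2 → ℝ)).symm.measurableEmbedding
  rw [periodCell_eq_preimage, (PiLp.volume_preserving_ofLp (Fin 2)).setIntegral_preimage_emb he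
    fun y => ∏ s, f s (y s), volume_pi, Measure.restrict_pi_pi, integral_fintype_prod_eq_prod]

theorem integral_periodCell_planeWave (m : Idx) :
    ∫ x in periodCell, planeWave (latticeVec m) x
      = if m = 0 then ((2 * Real.pi) ^ 2 : ℂ) else 0 := by
  simp_rw [planeWave_latticeVec]
  rw [integral_periodCell_prod fun s y => Complex.exp (Complex.I * m s * y)]
  simp_rw [integral_exp_int_mul]
  split_ifs with hm
  · simp [hm]
  · obtain ⟨s, hs⟩ := Function.ne_iff.mp hm
    exact Finset.prod_eq_zero (Finset.mem_univ s) (if_neg hs)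

theorem fourierCoef_planeWave (m n : Idx) :
    fourierCoef (planeWave (latticeVec m)) n = WienerAlgebra.single m 1 n := by
  have h (x : Plane) : planeWave (latticeVec m) x * planeWave (-latticeVec n) x
      = planeWave (latticeVec (m - n)) x := by
    rw [← planeWave_add, sub_eq_add_neg, latticeVec_add, latticeVec_neg]
  have hπ : (Real.pi : ℂ) ≠ 0 := by exact_mod_cast Real.pi_ne_zero
  rw [fourierCoef]
  simp_rw [h, integral_periodCell_planeWave]
  by_cases hmn : n = m
  · rw [hmn, if_pos (sub_self m), WienerAlgebra.single_apply_self]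
    field_simp
  · rw [if_neg (sub_ne_zero.mpr (Ne.symm hmn)), WienerAlgebra.single_apply_of_ne hmn, mul_zero]

end PlaneWaves

section Synthesis

/-- The function with Fourier coefficients `f`, that is, the sum `∑ f_m e^{i⟨m, x⟩}`. -/
def synth : WienerAlgebra Idx →L[ℂ] Plane →ᵇ ℂ :=
  WienerAlgebra.lift
    (fun m => .ofNormedAddCommGroup (planeWave (latticeVec m)) (continuous_planeWave _) 1
      fun _ => (norm_planeWave _ _).le)
    zero_le_one fun _ => BoundedContinuousFunction.norm_ofNormedAddCommGroup_le _ zero_le_one _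

theorem synth_single (m : Idx) (c : ℂ) (x : Plane) :
    synth (.single m c) x = c * planeWave (latticeVec m) x := by
  rw [synth, WienerAlgebra.lift_single]
  rfl

theorem synth_apply (f : WienerAlgebra Idx) (x : Plane) :
    synth f x = ∑' m, f m * planeWave (latticeVec m) x := by
  have h : BoundedContinuousFunction.evalCLM ℂ x ∘L synth
      = WienerAlgebra.lift (fun m => planeWave (latticeVec m) x) zero_le_one
        fun _ => (norm_planeWave _ _).le := WienerAlgebra.clm_ext fun m => by
    rw [WienerAlgebra.lift_single]
    exact synth_single m 1 x
  exact congr($h f)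

theorem synth_mul (f g : WienerAlgebra Idx) : synth (f * g) = synth f * synth g := by
  have h : ContinuousLinearMap.compL ℂ _ _ _ synth ∘L WienerAlgebra.convolution
      = (ContinuousLinearMap.mul ℂ _).bilinearComp synth synth :=
    WienerAlgebra.clm_ext fun m => WienerAlgebra.clm_ext fun n => by
      ext x
      change synth (.single m 1 * .single n 1) x = synth (.single m 1) x * synth (.single n 1) x
      simp only [WienerAlgebra.single_mul_single, synth_single, latticeVec_add, planeWave_add,
        one_mul]
  exact congr($h f g)

theorem synth_star (f : WienerAlgebra Idx) : synth (star f) = star (synth f) := by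
  ext x
  rw [BoundedContinuousFunction.star_apply, synth_apply, synth_apply, tsum_star,
    ← (Equiv.neg Idx).tsum_eq]
  refine tsum_congr fun m => ?_
  rw [WienerAlgebra.star_apply, Equiv.neg_apply, neg_neg, latticeVec_neg, planeWave_neg, star_mul']

theorem synth_cubic_apply (f : WienerAlgebra Idx) (x : Plane) :
    synth f.cubic x = (‖synth f x‖ : ℂ) ^ 2 * synth f x := by
  rw [WienerAlgebra.cubic, synth_mul, synth_mul, synth_star, ← Complex.mul_conj']
  simp only [BoundedContinuousFunction.mul_apply, BoundedContinuousFunction.star_apply]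
  rw [starRingEnd_apply]
  ring

theorem isPeriodic_synth (f : WienerAlgebra Idx) : IsPeriodic (synth f) := fun x s => by
  simp_rw [synth_apply, isPeriodic_planeWave_latticeVec _ x s]

/-- The `m`-th Fourier coefficient, as a continuous linear functional. -/
def fourierCoefCLM (m : Idx) : (Plane →ᵇ ℂ) →L[ℂ] ℂ :=
  have hint (f : Plane →ᵇ ℂ) :
      IntegrableOn (fun x => f x * planeWave (-latticeVec m) x) periodCell :=
    (f.integrable _).mul_bdd (c := 1) (continuous_planeWave _).aestronglyMeasurable
      (.of_forall fun _ => (norm_planeWave _ _).le)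
  LinearMap.mkContinuous
    { toFun f := fourierCoef f m
      map_add' f g := by
        simp only [fourierCoef, BoundedContinuousFunction.add_apply, add_mul,
          integral_add (hint f) (hint g), mul_add]
      map_smul' c f := by
        simp only [fourierCoef, BoundedContinuousFunction.smul_apply, smul_eq_mul, mul_assoc,
          integral_const_mul, RingHom.id_apply]
        ring }
    (‖(1 / (2 * Real.pi) ^ 2 : ℂ)‖ * volume.real periodCell) fun f => by
      refine (norm_mul_le _ _).trans ?_
      rw [mul_assoc]
      refine mul_le_mul_of_nonneg_left ?_ (norm_nonneg _)
      rw [mul_comm]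
      refine norm_setIntegral_le_of_norm_le_const volume_periodCell_lt_top fun x _ => ?_
      rw [norm_mul, norm_planeWave, mul_one]
      exact f.norm_coe_le_norm x

theorem fourierCoef_synth (f : WienerAlgebra Idx) (m : Idx) : fourierCoef (synth f) m = f m := by
  have h : fourierCoefCLM m ∘L synth = WienerAlgebra.coeff m := WienerAlgebra.clm_ext fun n => by
    have hn : ⇑(synth (.single n 1)) = planeWave (latticeVec n) := by
      ext x
      rw [synth_single, one_mul]
    change fourierCoef (synth (.single n 1)) m = WienerAlgebra.single n 1 m
    rw [hn, fourierCoef_planeWave]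
  exact congr($h f)

theorem starNorm_synth (f : WienerAlgebra Idx) : starNorm (synth f) = ENNReal.ofReal ‖f‖ := by
  rw [starNorm, f.norm_eq_tsum, ENNReal.ofReal_tsum_of_nonneg (fun _ => norm_nonneg _)
    f.summable_norm]
  exact tsum_congr fun m => by rw [fourierCoef_synth, ofReal_norm]

theorem synth_injective : Function.Injective synth := fun f g h => by
  ext m
  rw [← fourierCoef_synth f, h, fourierCoef_synth]

theorem synth_ofFinsupp (v : Idx →₀ ℂ) : ⇑(synth (.ofFinsupp v)) = trigPoly v := by
  ext x
  rw [synth_apply, trigPoly, Finsupp.sum, tsum_eq_sum (s := v.support) fun m hm => by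
    rw [WienerAlgebra.ofFinsupp_apply, Finsupp.notMem_support_iff.mp hm, zero_mul]]
  rfl

end Synthesis

section Laplacian

theorem laplacian_tsum {ι E F : Type*} [NormedAddCommGroup E] [InnerProductSpace ℝ E]
    [FiniteDimensional ℝ E] [NormedAddCommGroup F] [NormedSpace ℝ F] [CompleteSpace F]
    {f : ι → E → F} {b : ℕ → ι → ℝ} (hf : ∀ i, ContDiff ℝ 2 (f i))
    (hb : ∀ n : ℕ, (n : ℕ∞) ≤ 2 → Summable (b n))
    (hfb : ∀ (n : ℕ) (i : ι) (x : E), (n : ℕ∞) ≤ 2 → ‖iteratedFDeriv ℝ n (f i) x‖ ≤ b n i)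
    (x : E) :
    Laplacian.laplacian (fun y => ∑' i, f i y) x = ∑' i, Laplacian.laplacian (f i) x := by
  have hs : HasSum (fun i => iteratedFDeriv ℝ 2 (f i) x)
      (iteratedFDeriv ℝ 2 (fun y => ∑' i, f i y) x) := by
    rw [iteratedFDeriv_tsum_apply (N := 2) hf hb hfb le_rfl]
    exact (Summable.of_norm_bounded (hb 2 le_rfl) fun i => hfb 2 i x le_rfl).hasSum
  have happ (y : Fin 2 → E) := hs.mapL (ContinuousMultilinearMap.apply ℝ (fun _ => E) F y)
  simp_rw [InnerProductSpace.laplacian_eq_iteratedFDeriv_stdOrthonormalBasis]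
  exact (hasSum_sum fun s _ => happ _).tsum_eq.symm

theorem contDiff_exp_ofReal_mul_I {n : WithTop ℕ∞} :
    ContDiff ℝ n fun r : ℝ => Complex.exp (r * Complex.I) :=
  (Complex.ofRealCLM.contDiff.mul contDiff_const).cexp

theorem iteratedDeriv_exp_ofReal_mul_I (n : ℕ) :
    iteratedDeriv n (fun r : ℝ => Complex.exp (r * Complex.I))
      = fun r : ℝ => Complex.I ^ n * Complex.exp (r * Complex.I) := by
  induction n with
  | zero => simp
  | succ n ih =>
    have h (r : ℝ) : HasDerivAt (fun r : ℝ => Complex.exp (r * Complex.I))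
        (Complex.exp (r * Complex.I) * (1 * Complex.I)) r :=
      ((Complex.ofRealCLM.hasDerivAt (x := r)).mul_const Complex.I).cexp
    ext r
    rw [iteratedDeriv_succ, ih, ((h r).const_mul (Complex.I ^ n)).deriv]
    ring

theorem planeWave_eq_comp (ξ : Plane) :
    planeWave ξ = (fun r : ℝ => Complex.exp (r * Complex.I)) ∘ innerSL ℝ ξ := by
  ext x
  simp [planeWave, mul_comm]

theorem contDiff_planeWave {n : WithTop ℕ∞} (ξ : Plane) : ContDiff ℝ n (planeWave ξ) := by
  rw [planeWave_eq_comp]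
  exact contDiff_exp_ofReal_mul_I.comp (innerSL ℝ ξ).contDiff

theorem iteratedFDeriv_planeWave_apply (ξ x : Plane) (n : ℕ) (y : Fin n → Plane) :
    iteratedFDeriv ℝ n (planeWave ξ) x y
      = (∏ i, (inner ℝ ξ (y i) : ℂ)) * (Complex.I ^ n * planeWave ξ x) := by
  conv_lhs => rw [planeWave_eq_comp]
  rw [(innerSL ℝ ξ).iteratedFDeriv_comp_right (contDiff_exp_ofReal_mul_I (n := n)) x le_rfl,
    ContinuousMultilinearMap.compContinuousLinearMap_apply,
    iteratedFDeriv_apply_eq_iteratedDeriv_mul_prod, iteratedDeriv_exp_ofReal_mul_I]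
  simp [planeWave, mul_comm]

theorem norm_iteratedFDeriv_planeWave_le (ξ x : Plane) (n : ℕ) :
    ‖iteratedFDeriv ℝ n (planeWave ξ) x‖ ≤ ‖ξ‖ ^ n := by
  refine ContinuousMultilinearMap.opNorm_le_bound (by positivity) fun y => ?_
  rw [iteratedFDeriv_planeWave_apply, norm_mul, norm_mul, norm_pow, Complex.norm_I, one_pow,
    norm_planeWave, one_mul, mul_one, norm_prod]
  calc ∏ i, ‖((inner ℝ ξ (y i) : ℝ) : ℂ)‖ ≤ ∏ i, ‖ξ‖ * ‖y i‖ :=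
        Finset.prod_le_prod (fun _ _ => norm_nonneg _) fun i _ => by
          rw [Complex.norm_real]
          exact norm_inner_le_norm _ _
    _ = ‖ξ‖ ^ n * ∏ i, ‖y i‖ := by simp [Finset.prod_mul_distrib]

theorem laplacian_planeWave (ξ x : Plane) :
    Laplacian.laplacian (planeWave ξ) x = -((‖ξ‖ ^ 2 : ℝ) * planeWave ξ x) := by
  rw [InnerProductSpace.laplacian_eq_iteratedFDeriv_orthonormalBasis _
    (EuclideanSpace.basisFun (Fin 2) ℝ), EuclideanSpace.real_norm_sq_eq]
  simp only [iteratedFDeriv_planeWave_apply]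
  simp [EuclideanSpace.inner_single_right]
  ring

section Series

variable {ι : Type*} {c : ι → ℂ} {ξ : ι → Plane}

theorem contDiff_const_smul_planeWave (c : ℂ) (ξ : Plane) {n : WithTop ℕ∞} :
    ContDiff ℝ n (c • planeWave ξ) := (contDiff_planeWave ξ).const_smul c

theorem norm_iteratedFDeriv_const_smul_planeWave_le (c : ℂ) (ξ x : Plane) (n : ℕ) :
    ‖iteratedFDeriv ℝ n (c • planeWave ξ) x‖ ≤ ‖c‖ * ‖ξ‖ ^ n := by
  rw [iteratedFDeriv_const_smul_apply (contDiff_planeWave ξ).contDiffAt, norm_smul]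
  exact mul_le_mul_of_nonneg_left (norm_iteratedFDeriv_planeWave_le _ _ _) (norm_nonneg _)

theorem summable_norm_mul_pow_of_le_two (h0 : Summable fun i => ‖c i‖)
    (h2 : Summable fun i => ‖c i‖ * ‖ξ i‖ ^ 2) (n : ℕ) (hn : (n : ℕ∞) ≤ 2) :
    Summable fun i => ‖c i‖ * ‖ξ i‖ ^ n := by
  refine .of_nonneg_of_le (fun i => by positivity) (fun i => ?_) (h0.add h2)
  rw [← mul_one_add]
  refine mul_le_mul_of_nonneg_left ?_ (norm_nonneg _)
  have hn' : n ≤ 2 := by exact_mod_cast hn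
  interval_cases n <;> nlinarith [sq_nonneg (‖ξ i‖ - 1)]

theorem contDiff_tsum_planeWave (h0 : Summable fun i => ‖c i‖)
    (h2 : Summable fun i => ‖c i‖ * ‖ξ i‖ ^ 2) :
    ContDiff ℝ 2 fun x => ∑' i, c i * planeWave (ξ i) x :=
  contDiff_tsum (N := 2) (f := fun i => c i • planeWave (ξ i))
    (fun _ => contDiff_const_smul_planeWave _ _) (summable_norm_mul_pow_of_le_two h0 h2)
    fun _ _ _ _ => norm_iteratedFDeriv_const_smul_planeWave_le _ _ _ _

theorem laplacian_tsum_planeWave (h0 : Summable fun i => ‖c i‖)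
    (h2 : Summable fun i => ‖c i‖ * ‖ξ i‖ ^ 2) (x : Plane) :
    Laplacian.laplacian (fun x => ∑' i, c i * planeWave (ξ i) x) x
      = -∑' i, (‖ξ i‖ ^ 2 : ℝ) * (c i * planeWave (ξ i) x) := by
  have hterm (i : ι) : Laplacian.laplacian (c i • planeWave (ξ i)) x
      = -((‖ξ i‖ ^ 2 : ℝ) * (c i * planeWave (ξ i) x)) := by
    rw [InnerProductSpace.laplacian_smul _ (contDiff_planeWave _).contDiffAt, laplacian_planeWave,
      smul_eq_mul]
    ring
  refine (laplacian_tsum (f := fun i => c i • planeWave (ξ i))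
    (fun _ => contDiff_const_smul_planeWave _ _) (summable_norm_mul_pow_of_le_two h0 h2)
    (fun _ _ _ _ => norm_iteratedFDeriv_const_smul_planeWave_le _ _ _ _) x).trans ?_
  rw [← tsum_neg]
  exact tsum_congr hterm

end Series

end Laplacian

section ModeSystem

/-- The nonlinear eigenvalue problem `(p + v *) f + σ |f|² f = lam f` in terms of Fourier
coefficients: `p` is the symbol of the free operator and `v` the sequence of coefficients of the
potential. -/
def SolvesModeSystem {G : Type*} [AddCommGroup G] (p : G → ℝ) (v : WienerAlgebra G) (σ : ℝ)
    (lam : ℂ) (f : WienerAlgebra G) : Prop :=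
  ∀ m, (p m - lam) * f m + (v * f) m + σ * f.cubic m = 0

theorem im_eq_zero_of_forall_mul_apply_eq {G : Type*} [AddCommGroup G] {p : G → ℝ} {mu : ℂ}
    {w f : WienerAlgebra G} (hw : IsSelfAdjoint w) (hf : f ≠ 0)
    (h : ∀ m, (w * f) m = (mu - p m) * f m) : mu.im = 0 := by
  have hsa : IsSelfAdjoint (w * f * star f) := by
    rw [mul_assoc]
    exact hw.mul (.mul_star_self f)
  have hterm (n : G) : ((w * f) n * star f (0 - n)).im = mu.im * ‖f n‖ ^ 2 := by
    rw [h, zero_sub, WienerAlgebra.star_apply, neg_neg, mul_assoc, ← starRingEnd_apply,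
      Complex.mul_conj', ← Complex.ofReal_pow, Complex.im_mul_ofReal, Complex.sub_im,
      Complex.ofReal_im, sub_zero]
  have hsum : Summable fun n => ‖f n‖ ^ 2 := by
    refine .of_nonneg_of_le (fun n => by positivity) (fun n => ?_) (f.summable_norm.mul_left ‖f‖)
    rw [sq]
    exact mul_le_mul_of_nonneg_right (f.norm_apply_le n) (norm_nonneg _)
  have hzero : mu.im * ∑' n, ‖f n‖ ^ 2 = 0 := by
    have him : ((w * f * star f) 0).im = 0 := by
      rw [← Complex.conj_eq_iff_im, starRingEnd_apply]
      conv_rhs => rw [← hsa.star_eq, WienerAlgebra.star_apply, neg_zero]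
    rw [← him, WienerAlgebra.mul_apply, Complex.im_tsum, ← tsum_mul_left]
    · exact tsum_congr fun n => (hterm n).symm
    · exact WienerAlgebra.summable_smul (fun n => (star f).norm_apply_le (0 - n)) (w * f)
  obtain ⟨n, hn⟩ := DFunLike.ne_iff.mp hf
  exact (mul_eq_zero.mp hzero).resolve_right
    (hsum.tsum_pos (fun n => by positivity) n (by positivity)).ne'

theorem SolvesModeSystem.im_eq_zero {G : Type*} [AddCommGroup G] {p : G → ℝ}
    {v f : WienerAlgebra G} {σ : ℝ} {lam : ℂ} (hv : IsSelfAdjoint v) (hf : f ≠ 0)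
    (h : SolvesModeSystem p v σ lam f) : lam.im = 0 := by
  have hw : IsSelfAdjoint (v + (σ : ℂ) • (f * star f)) :=
    hv.add (.smul (Complex.conj_ofReal σ) (.mul_star_self f))
  refine im_eq_zero_of_forall_mul_apply_eq (p := p) hw hf fun m => ?_
  have hcubic : f * star f * f = f.cubic := by rw [WienerAlgebra.cubic]; ring
  rw [add_mul, smul_mul_assoc, hcubic, WienerAlgebra.add_apply, WienerAlgebra.smul_apply]
  linear_combination h m

theorem P_add (j m : Idx) (t : Plane) : P (j + m) t = P j t + latticeVec m := by
  rw [P, P, latticeVec_add]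
  abel

theorem planeWave_P_add (j m : Idx) (t x : Plane) :
    planeWave (P (j + m) t) x = planeWave (P j t) x * planeWave (latticeVec m) x := by
  rw [P_add, planeWave_add]

theorem const_mul_planeWave_mul_synth (B : ℂ) (j : Idx) (t : Plane) (f : WienerAlgebra Idx)
    (x : Plane) :
    B * planeWave (P j t) x * synth f x = ∑' m, B * f m * planeWave (P (j + m) t) x := by
  rw [synth_apply, ← tsum_mul_left]
  refine tsum_congr fun m => ?_
  rw [planeWave_P_add]
  ring

theorem SolvesModeSystem.isSolution {v f : WienerAlgebra Idx} {j : Idx} {t : Plane} {σ lam : ℝ}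
    {B : ℂ} (h : SolvesModeSystem (fun m => pSq (j + m) t) v (σ * ‖B‖ ^ 2) lam f) :
    IsSolution (synth v) σ lam fun x => B * planeWave (P j t) x * synth f x := by
  let g : WienerAlgebra Idx := (lam : ℂ) • f - v * f - ((σ * ‖B‖ ^ 2 : ℝ) : ℂ) • f.cubic
  have hg (m : Idx) : g m = pSq (j + m) t * f m := by
    simp only [g, WienerAlgebra.sub_apply, WienerAlgebra.smul_apply]
    linear_combination -h m
  have hu : (fun x => B * planeWave (P j t) x * synth f x)
      = fun x => ∑' m, B * f m * planeWave (P (j + m) t) x :=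
    funext (const_mul_planeWave_mul_synth B j t f)
  have h0 : Summable fun m => ‖B * f m‖ := by
    simp_rw [norm_mul]
    exact f.summable_norm.mul_left _
  have h2 : Summable fun m => ‖B * f m‖ * ‖P (j + m) t‖ ^ 2 := by
    refine (g.summable_norm.mul_left ‖B‖).congr fun m => ?_
    rw [hg, norm_mul, norm_mul, Complex.norm_real, pSq, Real.norm_of_nonneg (by positivity)]
    ring
  refine ⟨hu ▸ contDiff_tsum_planeWave h0 h2, fun x => ?_⟩
  have hlap : Laplacian.laplacian (fun x => B * planeWave (P j t) x * synth f x) x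
      = -(B * planeWave (P j t) x * synth g x) := by
    rw [hu, laplacian_tsum_planeWave h0 h2, const_mul_planeWave_mul_synth]
    congr 1
    refine tsum_congr fun m => ?_
    rw [hg, pSq]
    ring
  have hsynth : synth g x = lam * synth f x - synth v x * synth f x
      - ((σ * ‖B‖ ^ 2 : ℝ) : ℂ) * ((‖synth f x‖ : ℂ) ^ 2 * synth f x) := by
    rw [← synth_cubic_apply]
    simp only [g, map_sub, map_smul, synth_mul]
    rfl
  rw [hlap, hsynth, norm_mul, norm_mul, norm_planeWave]
  push_cast
  ring

theorem exp_two_pi_mul_P (j : Idx) (t : Plane) (s : Fin 2) :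
    Complex.exp (2 * Real.pi * Complex.I * (P j t s : ℂ))
      = Complex.exp (2 * Real.pi * Complex.I * (t s : ℂ)) := by
  refine Complex.exp_eq_exp_iff_exists_int.mpr ⟨j s, ?_⟩
  have h : P j t s = j s + t s := rfl
  rw [h]
  push_cast
  ring

theorem isQuasiPeriodic_of_forall_add_period {t : Plane} {u : Plane → ℂ} (hd : Differentiable ℝ u)
    (h : ∀ x s, u (x + period s) = Complex.exp (2 * Real.pi * Complex.I * (t s : ℂ)) * u x) :
    IsQuasiPeriodic t u := by
  refine fun x s => ⟨h x s, ?_⟩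
  rw [partialDeriv, partialDeriv, ← fderiv_comp_add_right]
  simp_rw [h _ s]
  rw [fderiv_const_mul (hd x), _root_.smul_apply, smul_eq_mul]

theorem isQuasiPeriodic_planeWave_mul {j : Idx} {t : Plane} {B : ℂ} {F : Plane → ℂ}
    (hd : Differentiable ℝ fun x => B * planeWave (P j t) x * F x) (hF : IsPeriodic F) :
    IsQuasiPeriodic t fun x => B * planeWave (P j t) x * F x := by
  refine isQuasiPeriodic_of_forall_add_period hd fun x s => ?_
  rw [hF, planeWave_add_period, exp_two_pi_mul_P]
  ring

end ModeSystem

namespace WienerAlgebra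

section Diag

variable {G : Type*} (r : G → ℂ) {C : ℝ} (hC : 0 ≤ C) (hr : ∀ m, ‖r m‖ ≤ C)

/-- Coefficientwise multiplication by a bounded family. -/
def diag : WienerAlgebra G →L[ℂ] WienerAlgebra G :=
  lift (fun m => single m (r m)) hC fun m => (norm_single m (r m)).trans_le (hr m)

theorem norm_diag_apply_le (f : WienerAlgebra G) : ‖diag r hC hr f‖ ≤ C * ‖f‖ :=
  (diag r hC hr).le_of_opNorm_le (norm_lift_le _ _ _) f

theorem diag_apply (f : WienerAlgebra G) (m : G) : diag r hC hr f m = r m * f m := by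
  have h : coeff m ∘L diag r hC hr = r m • coeff m := clm_ext fun n => by
    rw [ContinuousLinearMap.comp_apply, diag, lift_single, one_smul, coeff_apply,
      _root_.smul_apply, coeff_apply, smul_eq_mul]
    by_cases hmn : m = n
    · rw [hmn, single_apply_self, single_apply_self, mul_one]
    · rw [single_apply_of_ne hmn, single_apply_of_ne hmn, mul_zero]
  exact congr($h f)

end Diag

section TwoMode

variable {G : Type*} [AddCommGroup G] {q : G}

/-- The element with coefficients `c` at `0` and `d` at `-q`, the two indices that resonate. -/
def twoMode (q : G) (c d : ℂ) : WienerAlgebra G := single 0 c + single (-q) d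

theorem norm_twoMode_le (q : G) (c d : ℂ) : ‖twoMode q c d‖ ≤ ‖c‖ + ‖d‖ := by
  refine (norm_add_le _ _).trans_eq ?_
  rw [norm_single, norm_single]

theorem twoMode_apply_zero (hq : q ≠ 0) (c d : ℂ) : twoMode q c d 0 = c := by
  rw [twoMode, add_apply, single_apply_self, single_apply_of_ne (neg_ne_zero.mpr hq).symm,
    add_zero]

theorem twoMode_apply_neg (hq : q ≠ 0) (c d : ℂ) : twoMode q c d (-q) = d := by
  rw [twoMode, add_apply, single_apply_self, single_apply_of_ne (neg_ne_zero.mpr hq), zero_add]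

theorem twoMode_apply_of_ne {m : G} (h0 : m ≠ 0) (hq : m ≠ -q) (c d : ℂ) :
    twoMode q c d m = 0 := by
  rw [twoMode, add_apply, single_apply_of_ne h0, single_apply_of_ne hq, add_zero]

theorem smul_twoMode (q : G) (r c d : ℂ) : r • twoMode q c d = twoMode q (r * c) (r * d) := by
  rw [twoMode, twoMode, smul_add, smul_single, smul_single]

theorem mul_twoMode_apply (f : WienerAlgebra G) (q : G) (c d : ℂ) (m : G) :
    (f * twoMode q c d) m = f m * c + f (m + q) * d := by
  rw [twoMode, mul_add, add_apply, mul_single_apply, mul_single_apply, sub_zero, sub_neg_eq_add]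

/-- The functional `f ↦ c f_0 + d f_{-q}`. -/
def pair (q : G) (c d : ℂ) : WienerAlgebra G →L[ℂ] ℂ := c • coeff 0 + d • coeff (-q)

theorem pair_apply (q : G) (c d : ℂ) (f : WienerAlgebra G) :
    pair q c d f = c * f 0 + d * f (-q) := rfl

theorem norm_apply_zero_add_norm_apply_neg_le (hq : q ≠ 0) (f : WienerAlgebra G) :
    ‖f 0‖ + ‖f (-q)‖ ≤ ‖f‖ := by
  classical
  rw [norm_eq_tsum, ← Finset.sum_pair (f := fun m => ‖f m‖) (neg_ne_zero.mpr hq).symm]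
  exact f.summable_norm.sum_le_tsum _ fun _ _ => norm_nonneg _

theorem norm_pair_apply_le (hq : q ≠ 0) {c d : ℂ} (hc : ‖c‖ ≤ 1) (hd : ‖d‖ ≤ 1)
    (f : WienerAlgebra G) : ‖pair q c d f‖ ≤ ‖f‖ :=
  calc ‖pair q c d f‖
      ≤ ‖c‖ * ‖f 0‖ + ‖d‖ * ‖f (-q)‖ := by
        rw [pair_apply, ← norm_mul, ← norm_mul]
        exact norm_add_le _ _
    _ ≤ ‖f 0‖ + ‖f (-q)‖ :=
        add_le_add (mul_le_of_le_one_left (norm_nonneg _) hc)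
          (mul_le_of_le_one_left (norm_nonneg _) hd)
    _ ≤ ‖f‖ := norm_apply_zero_add_norm_apply_neg_le hq f

theorem cubic_twoMode_apply_zero (hq : q + q ≠ 0) (a b : ℂ) :
    cubic (twoMode q a b) 0 = (‖a‖ ^ 2 + 2 * ‖b‖ ^ 2) * a := by
  have hq0 : q ≠ 0 := fun h => hq (by rw [h, add_zero])
  have hqq : (0 : G) ≠ -q + -q := fun h => hq (neg_eq_zero.mp (by rw [neg_add, ← h]))
  simp only [cubic, twoMode, add_mul, mul_add, star_add, star_single, single_mul_single, neg_neg,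
    neg_zero, add_zero, zero_add, neg_add_cancel, neg_add_cancel_right, add_apply,
    single_apply_self, single_apply_of_ne hqq, single_apply_of_ne hq0.symm,
    single_apply_of_ne (neg_ne_zero.mpr hq0).symm, ← Complex.mul_conj', starRingEnd_apply]
  ring

theorem cubic_twoMode_apply_neg (hq : q + q ≠ 0) (a b : ℂ) :
    cubic (twoMode q a b) (-q) = (2 * ‖a‖ ^ 2 + ‖b‖ ^ 2) * b := by
  have hq0 : q ≠ 0 := fun h => hq (by rw [h, add_zero])
  have hqq : -q ≠ -q + -q := fun h => hq0 (neg_eq_zero.mp (left_eq_add.mp h))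
  have hnq : -q ≠ q := fun h => hq (by rw [← eq_neg_iff_add_eq_zero, h])
  simp only [cubic, twoMode, add_mul, mul_add, star_add, star_single, single_mul_single, neg_neg,
    neg_zero, add_zero, zero_add, neg_add_cancel, neg_add_cancel_right, add_apply,
    single_apply_self, single_apply_of_ne hqq, single_apply_of_ne hnq,
    single_apply_of_ne (neg_ne_zero.mpr hq0),
    ← Complex.mul_conj', starRingEnd_apply]
  ring

theorem pair_cubic_twoMode (hq : q + q ≠ 0) (a b : ℂ) :
    pair q (-b) a (cubic (twoMode q a b)) = a * b * ((‖a‖ ^ 2 - ‖b‖ ^ 2 : ℝ) : ℂ) := by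
  rw [pair_apply, cubic_twoMode_apply_zero hq, cubic_twoMode_apply_neg hq]
  push_cast
  ring

theorem norm_pair_cubic_twoMode_le (hq : q + q ≠ 0) {a b : ℂ} (hab : ‖a‖ ^ 2 + ‖b‖ ^ 2 = 1) :
    ‖pair q (-b) a (cubic (twoMode q a b))‖ ≤ 1 / 2 := by
  have hmul : ‖a‖ * ‖b‖ ≤ 1 / 2 := by linarith [two_mul_le_add_sq ‖a‖ ‖b‖]
  have hsub : |‖a‖ ^ 2 - ‖b‖ ^ 2| ≤ 1 := by
    rw [abs_le]
    constructor <;> linarith [sq_nonneg ‖a‖, sq_nonneg ‖b‖]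
  rw [pair_cubic_twoMode hq, norm_mul, norm_mul, Complex.norm_real, Real.norm_eq_abs]
  calc ‖a‖ * ‖b‖ * |‖a‖ ^ 2 - ‖b‖ ^ 2| ≤ 1 / 2 * 1 := by gcongr
    _ = 1 / 2 := mul_one _

end TwoMode

end WienerAlgebra

open WienerAlgebra

/-- A two-mode resonance of the mode system with symbol `p` and potential `v`: `(a, b)` is a unit
eigenvector, with eigenvalue `lam`, of the block `((p_0, v_q), (v_{-q}, p_{-q}))`, whose other
eigenvalue `p_0 + p_{-q} - lam` lies at distance at least `2ε¹⁰` below, and the free eigenvalues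
off the block stay away from `lam`. -/
structure TwoModeResonance (G : Type*) [AddCommGroup G] where
  ε : ℝ
  σ : ℝ
  lam : ℝ
  q : G
  p : G → ℝ
  v : WienerAlgebra G
  a : ℂ
  b : ℂ
  eps_pos : 0 < ε
  eps_le : ε ≤ 1 / 1000
  coupling : |σ| ≤ ε ^ 11
  add_self_ne_zero : q + q ≠ 0
  isSelfAdjoint : IsSelfAdjoint v
  v_zero : v 0 = 0
  norm_v_le : ‖v‖ ≤ ε ^ 9
  unit : ‖a‖ ^ 2 + ‖b‖ ^ 2 = 1
  row_zero : (p 0 - lam) * a + v q * b = 0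
  row_neg : v (-q) * a + (p (-q) - lam) * b = 0
  two_mul_pow_le_gap : 2 * ε ^ 10 ≤ 2 * lam - p 0 - p (-q)
  separated : ∀ m, m ≠ 0 → m ≠ -q → ε ^ 6 ≤ 2 * |p m - lam|

namespace TwoModeResonance

variable {G : Type*} [AddCommGroup G] (S : TwoModeResonance G)

section Data

/-- The distance between the two eigenvalues of the block. -/
def gap : ℝ := 2 * S.lam - S.p 0 - S.p (-S.q)

/-- The weight given to the part of a correction off the block. Without it the block equation,
which is divided by a gap of size `ε¹⁰`, would be coupled too strongly to that part by the
potential of size `ε⁹`. -/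
def weight : ℝ := S.ε / 8

theorem weight_pos : 0 < S.weight := div_pos S.eps_pos (by norm_num)

theorem gap_pos : 0 < S.gap :=
  (mul_pos two_pos (pow_pos S.eps_pos 10)).trans_le S.two_mul_pow_le_gap

theorem pow_succ_le (n : ℕ) : S.ε ^ (n + 1) ≤ 1 / 1000 * S.ε ^ n := by
  rw [pow_succ']
  exact mul_le_mul_of_nonneg_right S.eps_le (pow_nonneg S.eps_pos.le n)

theorem q_ne_zero : S.q ≠ 0 := fun h => S.add_self_ne_zero (by rw [h, add_zero])

theorem norm_a_le_one : ‖S.a‖ ≤ 1 := by nlinarith [S.unit, sq_nonneg ‖S.b‖, norm_nonneg S.a]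

theorem norm_b_le_one : ‖S.b‖ ≤ 1 := by nlinarith [S.unit, sq_nonneg ‖S.a‖, norm_nonneg S.b]

theorem norm_a_add_norm_b_le : ‖S.a‖ + ‖S.b‖ ≤ 3 / 2 := by
  nlinarith [S.unit, sq_nonneg (‖S.a‖ - ‖S.b‖), norm_nonneg S.a, norm_nonneg S.b]

theorem one_le_norm_a_add_norm_b : 1 ≤ ‖S.a‖ + ‖S.b‖ := by
  nlinarith [S.unit, norm_nonneg S.a, norm_nonneg S.b]

theorem mul_star_add_mul_star : S.a * star S.a + S.b * star S.b = 1 := by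
  rw [← starRingEnd_apply, ← starRingEnd_apply, Complex.mul_conj', Complex.mul_conj']
  exact_mod_cast S.unit

theorem star_v (m : G) : star (S.v m) = S.v (-m) := by
  conv_rhs => rw [← S.isSelfAdjoint.star_eq, star_apply, neg_neg]

theorem star_row_zero : (S.p 0 - S.lam) * star S.a + S.v (-S.q) * star S.b = 0 := by
  simpa [star_v] using congr(star $(S.row_zero))

theorem star_row_neg : S.v S.q * star S.a + (S.p (-S.q) - S.lam) * star S.b = 0 := by
  simpa [star_v] using congr(star $(S.row_neg))

theorem norm_v_mul_le (f : WienerAlgebra G) : ‖S.v * f‖ ≤ S.ε ^ 9 * ‖f‖ :=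
  (norm_mul_le _ _).trans (mul_le_mul_of_nonneg_right S.norm_v_le (norm_nonneg f))

end Data

section Iteration

/-- The part of the ansatz orthogonal to the unperturbed eigenvector `(a, b)`. -/
def correction (y : ℂ × WienerAlgebra G) : WienerAlgebra G :=
  y.1 • twoMode S.q (-star S.b) (star S.a) + (S.weight : ℂ) • y.2

/-- The ansatz for the nonlinear eigenvector. -/
def ansatz (y : ℂ × WienerAlgebra G) : WienerAlgebra G := twoMode S.q S.a S.b + S.correction y

/-- The terms of the mode system that perturb the block. -/
def source (y : ℂ × WienerAlgebra G) : WienerAlgebra G :=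
  (S.weight : ℂ) • (S.v * y.2) + (S.σ : ℂ) • (S.ansatz y).cubic

/-- The shift of the eigenvalue, read off the block equation along `(a, b)`. -/
def eigShift (y : ℂ × WienerAlgebra G) : ℂ := pair S.q (star S.a) (star S.b) (S.source y)

/-- The right-hand side of the block equation orthogonal to `(a, b)`. -/
def innerDefect (y : ℂ × WienerAlgebra G) : ℂ :=
  pair S.q (-S.b) S.a (S.source y) - S.eigShift y * y.1

/-- The right-hand side of the equations off the block. -/
def outerDefect (y : ℂ × WienerAlgebra G) : WienerAlgebra G :=
  S.v * S.ansatz y + (S.σ : ℂ) • (S.ansatz y).cubic - S.eigShift y • (S.weight : ℂ) • y.2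

open Classical in
/-- The reciprocals of `p_m - lam` off the block `{0, -q}`, extended by `0`. -/
def resolventCoeff (m : G) : ℂ := if m = 0 ∨ m = -S.q then 0 else ((S.p m - S.lam : ℝ) : ℂ)⁻¹

theorem resolventCoeff_bound_nonneg : 0 ≤ 2 / S.ε ^ 6 :=
  div_nonneg zero_le_two (pow_nonneg S.eps_pos.le 6)

theorem norm_resolventCoeff_le (m : G) : ‖S.resolventCoeff m‖ ≤ 2 / S.ε ^ 6 := by
  rw [resolventCoeff]
  split_ifs with hm
  · rw [norm_zero]
    exact S.resolventCoeff_bound_nonneg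
  · push Not at hm
    have hpos := pow_pos S.eps_pos 6
    have hsep := S.separated m hm.1 hm.2
    rw [norm_inv, Complex.norm_real, Real.norm_eq_abs, ← inv_div]
    exact inv_anti₀ (by positivity) (by linarith)

/-- The resolvent of the free operator off the block. -/
def resolvent : WienerAlgebra G →L[ℂ] WienerAlgebra G :=
  diag S.resolventCoeff S.resolventCoeff_bound_nonneg S.norm_resolventCoeff_le

/-- The map whose fixed points are the corrections turning `(a, b)` into a nonlinear
eigenvector. -/
def iteration (y : ℂ × WienerAlgebra G) : ℂ × WienerAlgebra G :=
  ((S.gap : ℂ)⁻¹ * S.innerDefect y, -((S.weight : ℂ)⁻¹ • S.resolvent (S.outerDefect y)))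

end Iteration

section Estimates

variable {S} {y y' : ℂ × WienerAlgebra G}

theorem norm_correction_sub_le (S : TwoModeResonance G) (y y' : ℂ × WienerAlgebra G) :
    ‖S.correction y - S.correction y'‖ ≤ 2 * ‖y - y'‖ := by
  have hsub : S.correction y - S.correction y'
      = (y - y').1 • twoMode S.q (-star S.b) (star S.a) + (S.weight : ℂ) • (y - y').2 := by
    rw [correction, correction, Prod.fst_sub, Prod.snd_sub, sub_smul, smul_sub]
    abel
  have hmode : ‖twoMode S.q (-star S.b) (star S.a)‖ ≤ 3 / 2 := by
    refine (norm_twoMode_le _ _ _).trans ?_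
    rw [norm_neg, norm_star, norm_star, add_comm]
    exact S.norm_a_add_norm_b_le
  have hweight : S.weight ≤ 1 / 2 := by
    rw [weight]
    linarith [S.eps_le]
  calc ‖S.correction y - S.correction y'‖
      ≤ ‖(y - y').1‖ * ‖twoMode S.q (-star S.b) (star S.a)‖ + S.weight * ‖(y - y').2‖ := by
        rw [hsub]
        refine (norm_add_le _ _).trans_eq ?_
        rw [norm_smul, norm_smul, Complex.norm_real, Real.norm_of_nonneg S.weight_pos.le]
    _ ≤ ‖y - y'‖ * (3 / 2) + 1 / 2 * ‖y - y'‖ := by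
        gcongr
        · exact norm_fst_le (y - y')
        · exact norm_snd_le (y - y')
    _ = 2 * ‖y - y'‖ := by ring

theorem correction_zero (S : TwoModeResonance G) : S.correction 0 = 0 := by
  rw [correction, Prod.fst_zero, Prod.snd_zero, zero_smul, smul_zero, add_zero]

theorem ansatz_zero (S : TwoModeResonance G) : S.ansatz 0 = twoMode S.q S.a S.b := by
  rw [ansatz, correction_zero, add_zero]

theorem norm_correction_le (hy : ‖y‖ ≤ S.ε / 2) : ‖S.correction y‖ ≤ S.ε := by
  have h := S.norm_correction_sub_le y 0
  rw [correction_zero, sub_zero, sub_zero] at h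
  linarith

theorem norm_twoMode_ab_le (S : TwoModeResonance G) : ‖twoMode S.q S.a S.b‖ ≤ 3 / 2 :=
  (norm_twoMode_le _ _ _).trans S.norm_a_add_norm_b_le

theorem norm_ansatz_le (hy : ‖y‖ ≤ S.ε / 2) : ‖S.ansatz y‖ ≤ 2 := by
  refine (norm_add_le _ _).trans ?_
  linarith [S.norm_twoMode_ab_le, norm_correction_le hy, S.eps_le]

theorem norm_ansatz_sub_le (S : TwoModeResonance G) (y y' : ℂ × WienerAlgebra G) :
    ‖S.ansatz y - S.ansatz y'‖ ≤ 2 * ‖y - y'‖ := by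
  rw [ansatz, ansatz, add_sub_add_left_eq_sub]
  exact S.norm_correction_sub_le y y'

theorem norm_coupling_smul_le (S : TwoModeResonance G) {f : WienerAlgebra G} {r : ℝ}
    (hf : ‖f‖ ≤ r) : ‖(S.σ : ℂ) • f‖ ≤ S.ε ^ 11 * r := by
  rw [norm_smul, Complex.norm_real, Real.norm_eq_abs]
  exact mul_le_mul S.coupling hf (norm_nonneg f) (pow_nonneg S.eps_pos.le 11)

theorem norm_smul_cubic_ansatz_sub_le (hy : ‖y‖ ≤ S.ε / 2) (hy' : ‖y'‖ ≤ S.ε / 2) :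
    ‖(S.σ : ℂ) • (S.ansatz y).cubic - (S.σ : ℂ) • (S.ansatz y').cubic‖
      ≤ S.ε ^ 11 * (24 * ‖y - y'‖) := by
  rw [← smul_sub]
  refine S.norm_coupling_smul_le ?_
  linarith [norm_cubic_sub_le (norm_ansatz_le hy) (norm_ansatz_le hy'), S.norm_ansatz_sub_le y y']

theorem norm_weight_smul_le (S : TwoModeResonance G) (f : WienerAlgebra G) :
    ‖(S.weight : ℂ) • f‖ ≤ ‖f‖ := by
  rw [norm_smul, Complex.norm_real, Real.norm_of_nonneg S.weight_pos.le]
  refine mul_le_of_le_one_left (norm_nonneg f) ?_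
  rw [weight]
  linarith [S.eps_le]

theorem norm_weight_smul_v_mul_le (S : TwoModeResonance G) (f : WienerAlgebra G) :
    ‖(S.weight : ℂ) • (S.v * f)‖ ≤ S.ε ^ 10 / 8 * ‖f‖ := by
  rw [norm_smul, Complex.norm_real, Real.norm_of_nonneg S.weight_pos.le]
  calc S.weight * ‖S.v * f‖ ≤ S.ε / 8 * (S.ε ^ 9 * ‖f‖) :=
        mul_le_mul_of_nonneg_left (S.norm_v_mul_le f) S.weight_pos.le
    _ = S.ε ^ 10 / 8 * ‖f‖ := by ring

theorem norm_source_le (hy : ‖y‖ ≤ S.ε / 2) : ‖S.source y‖ ≤ 9 * S.ε ^ 11 := by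
  have hε := S.eps_pos
  have hv : ‖(S.weight : ℂ) • (S.v * y.2)‖ ≤ S.ε ^ 10 / 8 * (S.ε / 2) :=
    (S.norm_weight_smul_v_mul_le y.2).trans (by gcongr; exact (norm_snd_le y).trans hy)
  have hcubic : ‖(S.σ : ℂ) • (S.ansatz y).cubic‖ ≤ S.ε ^ 11 * 2 ^ 3 :=
    S.norm_coupling_smul_le ((norm_cubic_le _).trans (by gcongr; exact norm_ansatz_le hy))
  refine (norm_add_le _ _).trans ?_
  linarith [pow_pos hε 11]

theorem norm_source_sub_le (hy : ‖y‖ ≤ S.ε / 2) (hy' : ‖y'‖ ≤ S.ε / 2) :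
    ‖S.source y - S.source y'‖ ≤ S.ε ^ 10 / 4 * ‖y - y'‖ := by
  have hε := S.eps_pos
  have hv : ‖(S.weight : ℂ) • (S.v * (y - y').2)‖ ≤ S.ε ^ 10 / 8 * ‖y - y'‖ :=
    (S.norm_weight_smul_v_mul_le _).trans (by gcongr; exact norm_snd_le (y - y'))
  rw [source, source, add_sub_add_comm, ← smul_sub, ← mul_sub, ← Prod.snd_sub]
  refine (norm_add_le _ _).trans ?_
  linarith [norm_smul_cubic_ansatz_sub_le hy hy',
    mul_le_mul_of_nonneg_right (S.pow_succ_le 10) (norm_nonneg (y - y')),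
    mul_nonneg (pow_pos hε 10).le (norm_nonneg (y - y'))]

theorem norm_pair_star_le (S : TwoModeResonance G) (f : WienerAlgebra G) :
    ‖pair S.q (star S.a) (star S.b) f‖ ≤ ‖f‖ :=
  norm_pair_apply_le S.q_ne_zero ((norm_star _).trans_le S.norm_a_le_one)
    ((norm_star _).trans_le S.norm_b_le_one) f

theorem norm_eigShift_le (hy : ‖y‖ ≤ S.ε / 2) : ‖S.eigShift y‖ ≤ 9 * S.ε ^ 11 :=
  (S.norm_pair_star_le _).trans (norm_source_le hy)

theorem norm_eigShift_sub_le (hy : ‖y‖ ≤ S.ε / 2) (hy' : ‖y'‖ ≤ S.ε / 2) :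
    ‖S.eigShift y - S.eigShift y'‖ ≤ S.ε ^ 10 / 4 * ‖y - y'‖ := by
  rw [eigShift, eigShift, ← map_sub]
  exact (S.norm_pair_star_le _).trans (norm_source_sub_le hy hy')

theorem norm_eigShift_smul_sub_le {V : Type*} [NormedAddCommGroup V] [NormedSpace ℂ V]
    (hy : ‖y‖ ≤ S.ε / 2) (hy' : ‖y'‖ ≤ S.ε / 2) {x x' : V} (hx : ‖x‖ ≤ S.ε / 2)
    (hxx' : ‖x - x'‖ ≤ ‖y - y'‖) :
    ‖S.eigShift y • x - S.eigShift y' • x'‖ ≤ 10 * S.ε ^ 11 * ‖y - y'‖ := by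
  have hε := S.eps_pos
  have hsplit : S.eigShift y • x - S.eigShift y' • x'
      = (S.eigShift y - S.eigShift y') • x + S.eigShift y' • (x - x') := by module
  calc ‖S.eigShift y • x - S.eigShift y' • x'‖
      ≤ ‖S.eigShift y - S.eigShift y'‖ * ‖x‖ + ‖S.eigShift y'‖ * ‖x - x'‖ := by
        rw [hsplit, ← norm_smul, ← norm_smul]
        exact norm_add_le _ _
    _ ≤ S.ε ^ 10 / 4 * ‖y - y'‖ * (S.ε / 2) + 9 * S.ε ^ 11 * ‖y - y'‖ := by
        gcongr
        · exact norm_eigShift_sub_le hy hy'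
        · exact norm_eigShift_le hy'
    _ ≤ 10 * S.ε ^ 11 * ‖y - y'‖ := by
        linarith [mul_nonneg (pow_pos hε 11).le (norm_nonneg (y - y'))]

theorem norm_innerDefect_sub_le (hy : ‖y‖ ≤ S.ε / 2) (hy' : ‖y'‖ ≤ S.ε / 2) :
    ‖S.innerDefect y - S.innerDefect y'‖ ≤ S.ε ^ 10 * ‖y - y'‖ := by
  have hpair : ‖pair S.q (-S.b) S.a (S.source y - S.source y')‖ ≤ S.ε ^ 10 / 4 * ‖y - y'‖ :=
    (norm_pair_apply_le S.q_ne_zero ((norm_neg _).trans_le S.norm_b_le_one) S.norm_a_le_one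
      _).trans (norm_source_sub_le hy hy')
  have hshift : ‖S.eigShift y * y.1 - S.eigShift y' * y'.1‖ ≤ 10 * S.ε ^ 11 * ‖y - y'‖ :=
    norm_eigShift_smul_sub_le hy hy' ((norm_fst_le y).trans hy) (norm_fst_le (y - y'))
  rw [innerDefect, innerDefect, sub_sub_sub_comm, ← map_sub]
  refine (norm_sub_le _ _).trans ?_
  linarith [mul_le_mul_of_nonneg_right (S.pow_succ_le 10) (norm_nonneg (y - y')),
    mul_nonneg (pow_pos S.eps_pos 10).le (norm_nonneg (y - y'))]

theorem norm_innerDefect_zero_le (S : TwoModeResonance G) : ‖S.innerDefect 0‖ ≤ S.ε ^ 11 / 2 := by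
  have h := mul_le_mul S.coupling (norm_pair_cubic_twoMode_le S.add_self_ne_zero S.unit)
    (norm_nonneg _) (pow_pos S.eps_pos 11).le
  rw [innerDefect, source, ansatz_zero, Prod.fst_zero, Prod.snd_zero, mul_zero, mul_zero,
    smul_zero, zero_add, sub_zero, map_smul, norm_smul, Complex.norm_real, Real.norm_eq_abs]
  linarith

theorem norm_outerDefect_sub_le (hy : ‖y‖ ≤ S.ε / 2) (hy' : ‖y'‖ ≤ S.ε / 2) :
    ‖S.outerDefect y - S.outerDefect y'‖ ≤ S.ε ^ 7 / 32 * ‖y - y'‖ := by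
  have hv : ‖S.v * (S.ansatz y - S.ansatz y')‖ ≤ S.ε ^ 9 * (2 * ‖y - y'‖) :=
    (S.norm_v_mul_le _).trans <|
      mul_le_mul_of_nonneg_left (S.norm_ansatz_sub_le y y') (pow_pos S.eps_pos 9).le
  have hshift := norm_eigShift_smul_sub_le hy hy' (x := (S.weight : ℂ) • y.2)
    (x' := (S.weight : ℂ) • y'.2)
    ((S.norm_weight_smul_le _).trans ((norm_snd_le y).trans hy))
    (by rw [← smul_sub]; exact (S.norm_weight_smul_le _).trans (norm_snd_le (y - y')))
  rw [outerDefect, outerDefect, sub_sub_sub_comm, add_sub_add_comm, ← mul_sub]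
  refine (norm_sub_le _ _).trans ((add_le_add_left (norm_add_le _ _) _).trans ?_)
  have hpow (n : ℕ) := mul_le_mul_of_nonneg_right (S.pow_succ_le n) (norm_nonneg (y - y'))
  linarith [norm_smul_cubic_ansatz_sub_le hy hy', hpow 7, hpow 8, hpow 9, hpow 10,
    mul_nonneg (pow_pos S.eps_pos 7).le (norm_nonneg (y - y'))]

theorem norm_outerDefect_zero_le (S : TwoModeResonance G) : ‖S.outerDefect 0‖ ≤ S.ε ^ 8 / 64 := by
  have hv : ‖S.v * twoMode S.q S.a S.b‖ ≤ S.ε ^ 9 * (3 / 2) :=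
    (S.norm_v_mul_le _).trans <|
      mul_le_mul_of_nonneg_left S.norm_twoMode_ab_le (pow_pos S.eps_pos 9).le
  have hcubic : ‖(S.σ : ℂ) • (twoMode S.q S.a S.b).cubic‖ ≤ S.ε ^ 11 * (3 / 2) ^ 3 :=
    S.norm_coupling_smul_le ((norm_cubic_le _).trans (by gcongr; exact S.norm_twoMode_ab_le))
  rw [outerDefect, ansatz_zero, Prod.snd_zero, smul_zero, smul_zero, sub_zero]
  refine (norm_add_le _ _).trans ?_
  linarith [S.pow_succ_le 8, S.pow_succ_le 9, S.pow_succ_le 10, pow_pos S.eps_pos 8]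

theorem norm_inv_gap_mul_le (S : TwoModeResonance G) (z : ℂ) :
    2 * S.ε ^ 10 * ‖(S.gap : ℂ)⁻¹ * z‖ ≤ ‖z‖ := by
  rw [norm_mul, norm_inv, Complex.norm_real, Real.norm_of_nonneg S.gap_pos.le, ← mul_assoc,
    ← div_eq_mul_inv]
  exact mul_le_of_le_one_left (norm_nonneg z) ((div_le_one S.gap_pos).mpr S.two_mul_pow_le_gap)

theorem norm_inv_weight_smul_resolvent_le (S : TwoModeResonance G) (f : WienerAlgebra G) :
    S.ε ^ 7 / 16 * ‖(S.weight : ℂ)⁻¹ • S.resolvent f‖ ≤ ‖f‖ := by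
  have hε := S.eps_pos
  rw [norm_smul, norm_inv, Complex.norm_real, Real.norm_of_nonneg S.weight_pos.le]
  calc S.ε ^ 7 / 16 * (S.weight⁻¹ * ‖S.resolvent f‖)
      ≤ S.ε ^ 7 / 16 * ((S.ε / 8)⁻¹ * (2 / S.ε ^ 6 * ‖f‖)) := by
        gcongr
        · exact le_rfl
        · exact norm_diag_apply_le _ _ _ f
    _ = ‖f‖ := by
        field_simp
        norm_num

theorem norm_iteration_sub_le (hy : ‖y‖ ≤ S.ε / 2) (hy' : ‖y'‖ ≤ S.ε / 2) :
    ‖S.iteration y - S.iteration y'‖ ≤ 1 / 2 * ‖y - y'‖ := by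
  rw [Prod.norm_def, max_le_iff]
  constructor
  · rw [Prod.fst_sub, iteration, iteration, ← mul_sub]
    have h := (S.norm_inv_gap_mul_le _).trans (norm_innerDefect_sub_le hy hy')
    nlinarith [pow_pos S.eps_pos 10]
  · rw [Prod.snd_sub, iteration, iteration, neg_sub_neg, ← smul_sub, ← map_sub]
    have h := (S.norm_inv_weight_smul_resolvent_le _).trans
      ((norm_sub_rev _ _).trans_le (norm_outerDefect_sub_le hy hy'))
    nlinarith [pow_pos S.eps_pos 7]

theorem norm_iteration_zero_le (S : TwoModeResonance G) : ‖S.iteration 0‖ ≤ S.ε / 4 := by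
  rw [Prod.norm_def, max_le_iff]
  constructor
  · have h := (S.norm_inv_gap_mul_le _).trans S.norm_innerDefect_zero_le
    rw [iteration]
    nlinarith [pow_pos S.eps_pos 10]
  · have h := (S.norm_inv_weight_smul_resolvent_le _).trans S.norm_outerDefect_zero_le
    rw [iteration, norm_neg]
    nlinarith [pow_pos S.eps_pos 7]

theorem exists_iteration_eq_self (S : TwoModeResonance G) :
    ∃ y : ℂ × WienerAlgebra G, ‖y‖ ≤ S.ε / 2 ∧ S.iteration y = y := by
  have hε := S.eps_pos
  have hmaps : Set.MapsTo S.iteration (Metric.closedBall 0 (S.ε / 2))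
      (Metric.closedBall 0 (S.ε / 2)) := fun y hy => by
    rw [mem_closedBall_zero_iff] at hy ⊢
    have hzero : ‖(0 : ℂ × WienerAlgebra G)‖ ≤ S.ε / 2 := by
      rw [norm_zero]
      positivity
    have hsub := norm_iteration_sub_le hy hzero
    rw [sub_zero] at hsub
    linarith [norm_le_norm_add_norm_sub' (S.iteration y) (S.iteration 0), S.norm_iteration_zero_le]
  have hcontr : ContractingWith (1 / 2) (hmaps.restrict S.iteration _ _) := by
    refine ⟨by norm_num, LipschitzWith.of_dist_le_mul fun y y' => ?_⟩
    simpa [Subtype.dist_eq, dist_eq_norm] using norm_iteration_sub_le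
      (mem_closedBall_zero_iff.mp y.2) (mem_closedBall_zero_iff.mp y'.2)
  obtain ⟨y, hy, hfix, -⟩ := hcontr.exists_fixedPoint' Metric.isClosed_closedBall.isComplete hmaps
    (Metric.mem_closedBall_self (by positivity)) (edist_ne_top _ _)
  exact ⟨y, mem_closedBall_zero_iff.mp hy, hfix⟩

end Estimates

section Solution

variable {S} {y : ℂ × WienerAlgebra G}

theorem weight_mul_snd_apply (hy : S.iteration y = y) (m : G) :
    S.weight * y.2 m = -(S.resolventCoeff m * S.outerDefect y m) := by
  have hw : (S.weight : ℂ) ≠ 0 := Complex.ofReal_ne_zero.mpr S.weight_pos.ne'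
  have h : (S.iteration y).2 m = y.2 m := by rw [hy]
  rw [iteration, neg_apply, smul_apply, resolvent, diag_apply] at h
  rw [← h, mul_neg, mul_inv_cancel_left₀ hw]

theorem snd_apply_eq_zero (hy : S.iteration y = y) {m : G} (hm : m = 0 ∨ m = -S.q) :
    y.2 m = 0 := by
  have h := weight_mul_snd_apply hy m
  rw [resolventCoeff, if_pos hm, zero_mul, neg_zero] at h
  exact (mul_eq_zero.mp h).resolve_left (Complex.ofReal_ne_zero.mpr S.weight_pos.ne')

theorem gap_mul_fst (hy : S.iteration y = y) :
    S.gap * y.1 = -S.b * S.source y 0 + S.a * S.source y (-S.q) - S.eigShift y * y.1 := by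
  have h : (S.iteration y).1 = y.1 := by rw [hy]
  rw [← pair_apply]
  exact ((inv_mul_eq_iff_eq_mul₀ (Complex.ofReal_ne_zero.mpr S.gap_pos.ne')).mp h).symm

theorem eigShift_eq (S : TwoModeResonance G) (y : ℂ × WienerAlgebra G) :
    S.eigShift y = star S.a * S.source y 0 + star S.b * S.source y (-S.q) := rfl

theorem ansatz_apply_zero (hy : S.iteration y = y) : S.ansatz y 0 = S.a - y.1 * star S.b := by
  rw [ansatz, correction, add_apply, add_apply, smul_apply, smul_apply,
    twoMode_apply_zero S.q_ne_zero, twoMode_apply_zero S.q_ne_zero,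
    snd_apply_eq_zero hy (.inl rfl)]
  ring

theorem ansatz_apply_neg (hy : S.iteration y = y) : S.ansatz y (-S.q) = S.b + y.1 * star S.a := by
  rw [ansatz, correction, add_apply, add_apply, smul_apply, smul_apply,
    twoMode_apply_neg S.q_ne_zero, twoMode_apply_neg S.q_ne_zero,
    snd_apply_eq_zero hy (.inr rfl)]
  ring

theorem ansatz_apply_of_ne (S : TwoModeResonance G) (y : ℂ × WienerAlgebra G) {m : G}
    (h0 : m ≠ 0) (hq : m ≠ -S.q) : S.ansatz y m = S.weight * y.2 m := by
  rw [ansatz, correction, add_apply, add_apply, smul_apply, smul_apply, twoMode_apply_of_ne h0 hq,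
    twoMode_apply_of_ne h0 hq]
  ring

theorem v_mul_ansatz_apply_add (S : TwoModeResonance G) (y : ℂ × WienerAlgebra G) (m : G) :
    (S.v * S.ansatz y) m + S.σ * (S.ansatz y).cubic m
      = S.v m * (S.a - y.1 * star S.b) + S.v (m + S.q) * (S.b + y.1 * star S.a)
        + S.source y m := by
  have h : (S.v * S.ansatz y) m = S.v m * S.a + S.v (m + S.q) * S.b
      + (y.1 * (S.v m * -star S.b + S.v (m + S.q) * star S.a) + S.weight * (S.v * y.2) m) := by
    rw [ansatz, correction, mul_add, mul_add, mul_smul_comm, mul_smul_comm, add_apply, add_apply,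
      smul_apply, smul_apply, mul_twoMode_apply, mul_twoMode_apply]
  rw [h, source, add_apply, smul_apply, smul_apply]
  ring

theorem equation_zero (hy : S.iteration y = y) :
    (S.p 0 - (S.lam + S.eigShift y)) * S.ansatz y 0 + (S.v * S.ansatz y) 0
      + S.σ * (S.ansatz y).cubic 0 = 0 := by
  have hβ := gap_mul_fst hy
  rw [gap] at hβ
  push_cast at hβ
  rw [add_assoc, v_mul_ansatz_apply_add, ansatz_apply_zero hy, S.v_zero, zero_add]
  linear_combination S.row_zero + y.1 * S.star_row_neg - S.a * S.eigShift_eq y + star S.b * hβ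
    - S.source y 0 * S.mul_star_add_mul_star

theorem equation_neg (hy : S.iteration y = y) :
    (S.p (-S.q) - (S.lam + S.eigShift y)) * S.ansatz y (-S.q) + (S.v * S.ansatz y) (-S.q)
      + S.σ * (S.ansatz y).cubic (-S.q) = 0 := by
  have hβ := gap_mul_fst hy
  rw [gap] at hβ
  push_cast at hβ
  rw [add_assoc, v_mul_ansatz_apply_add, ansatz_apply_neg hy, neg_add_cancel, S.v_zero]
  linear_combination S.row_neg - y.1 * S.star_row_zero - S.b * S.eigShift_eq y - star S.a * hβ
    - S.source y (-S.q) * S.mul_star_add_mul_star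

theorem equation_of_ne (hy : S.iteration y = y) {m : G} (h0 : m ≠ 0) (hq : m ≠ -S.q) :
    (S.p m - (S.lam + S.eigShift y)) * S.ansatz y m + (S.v * S.ansatz y) m
      + S.σ * (S.ansatz y).cubic m = 0 := by
  have hp : (S.p m - S.lam : ℂ) ≠ 0 := by
    have hsep := (pow_pos S.eps_pos 6).trans_le (S.separated m h0 hq)
    exact_mod_cast abs_pos.mp (pos_of_mul_pos_right hsep zero_le_two)
  have h := weight_mul_snd_apply hy m
  rw [resolventCoeff, if_neg (not_or.mpr ⟨h0, hq⟩), Complex.ofReal_sub, ← mul_neg,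
    eq_inv_mul_iff_mul_eq₀ hp, outerDefect, sub_apply, add_apply, smul_apply, smul_apply,
    smul_apply] at h
  rw [ansatz_apply_of_ne S y h0 hq]
  linear_combination h

theorem solvesModeSystem_ansatz (hy : S.iteration y = y) :
    SolvesModeSystem S.p S.v S.σ (S.lam + S.eigShift y) (S.ansatz y) := fun m => by
  by_cases h0 : m = 0
  · exact h0 ▸ equation_zero hy
  by_cases hq : m = -S.q
  · exact hq ▸ equation_neg hy
  exact equation_of_ne hy h0 hq

theorem ansatz_ne_zero (hy : ‖y‖ ≤ S.ε / 2) : S.ansatz y ≠ 0 := fun h => by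
  have hmode : 1 ≤ ‖twoMode S.q S.a S.b‖ := by
    refine S.one_le_norm_a_add_norm_b.trans ?_
    simpa only [twoMode_apply_zero S.q_ne_zero, twoMode_apply_neg S.q_ne_zero] using
      norm_apply_zero_add_norm_apply_neg_le S.q_ne_zero (twoMode S.q S.a S.b)
  rw [eq_neg_of_add_eq_zero_left h, norm_neg] at hmode
  linarith [norm_correction_le hy, S.eps_le]

theorem exists_solvesModeSystem (S : TwoModeResonance G) :
    ∃ (f : WienerAlgebra G) (mu : ℝ), SolvesModeSystem S.p S.v S.σ mu f ∧ f ≠ 0 ∧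
      ‖f - twoMode S.q S.a S.b‖ ≤ S.ε ∧ |mu - S.lam| ≤ 9 * S.ε ^ 11 := by
  obtain ⟨y, hy, hfix⟩ := S.exists_iteration_eq_self
  have hsol := solvesModeSystem_ansatz hfix
  have hne := ansatz_ne_zero hy
  obtain ⟨mu, hmu⟩ := Complex.conj_eq_iff_real.mp
    (Complex.conj_eq_iff_im.mpr (hsol.im_eq_zero S.isSelfAdjoint hne))
  refine ⟨S.ansatz y, mu, hmu ▸ hsol, hne, ?_, ?_⟩
  · rw [ansatz, add_sub_cancel_left]
    exact norm_correction_le hy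
  · rw [← Real.norm_eq_abs, ← Complex.norm_real, Complex.ofReal_sub, ← hmu, add_sub_cancel_left]
    exact norm_eigShift_le hy

end Solution

end TwoModeResonance

section Block

variable (x y : ℝ) (c : ℂ)

/-- The larger eigenvalue of the Hermitian matrix `((x, c), (c̄, y))`. -/
def topEigenvalue : ℝ := (x + y) / 2 + √(4 * ‖c‖ ^ 2 + (x - y) ^ 2) / 2

/-- The Euclidean length of `(y - lam, -c̄)`, an eigenvector of `((x, c), (c̄, y))` for its larger
eigenvalue `lam`; it vanishes if `c = 0` and `x ≤ y`. -/
def topVectorNorm : ℝ := √((y - topEigenvalue x y c) ^ 2 + ‖c‖ ^ 2)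

/-- The first component of the normalised eigenvector of `((x, c), (c̄, y))` for its larger
eigenvalue. -/
def topFst : ℝ := (y - topEigenvalue x y c) / topVectorNorm x y c

/-- The second component of the normalised eigenvector of `((x, c), (c̄, y))` for its larger
eigenvalue. -/
def topSnd : ℂ := -star c / topVectorNorm x y c

theorem sub_topEigenvalue_mul_sub_topEigenvalue :
    (x - topEigenvalue x y c) * (y - topEigenvalue x y c) = ‖c‖ ^ 2 := by
  have hsq : √(4 * ‖c‖ ^ 2 + (x - y) ^ 2) ^ 2 = 4 * ‖c‖ ^ 2 + (x - y) ^ 2 :=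
    Real.sq_sqrt (by positivity)
  rw [topEigenvalue]
  linear_combination hsq / 4

theorem two_mul_norm_le_two_mul_topEigenvalue_sub :
    2 * ‖c‖ ≤ 2 * topEigenvalue x y c - x - y := by
  have hsqrt : 2 * ‖c‖ ≤ √(4 * ‖c‖ ^ 2 + (x - y) ^ 2) :=
    Real.le_sqrt_of_sq_le (by linarith [sq_nonneg (x - y)])
  rw [topEigenvalue]
  linarith

theorem sq_topVectorNorm :
    topVectorNorm x y c ^ 2 = (y - topEigenvalue x y c) ^ 2 + ‖c‖ ^ 2 :=
  Real.sq_sqrt (by positivity)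

theorem norm_le_topVectorNorm : ‖c‖ ≤ topVectorNorm x y c :=
  Real.le_sqrt_of_sq_le (le_add_of_nonneg_left (sq_nonneg _))

theorem topVectorNorm_nonneg : 0 ≤ topVectorNorm x y c := Real.sqrt_nonneg _

theorem abs_topFst_le_one : |topFst x y c| ≤ 1 := by
  rw [topFst, abs_div, abs_of_nonneg (topVectorNorm_nonneg x y c)]
  exact div_le_one_of_le₀ (Real.abs_le_sqrt (le_add_of_nonneg_right (sq_nonneg _)))
    (topVectorNorm_nonneg x y c)

theorem norm_topSnd_le_one : ‖topSnd x y c‖ ≤ 1 := by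
  rw [topSnd, norm_div, norm_neg, norm_star, Complex.norm_real,
    Real.norm_of_nonneg (topVectorNorm_nonneg x y c)]
  exact div_le_one_of_le₀ (norm_le_topVectorNorm x y c) (topVectorNorm_nonneg x y c)

theorem sub_topEigenvalue_mul_topFst_add :
    (x - topEigenvalue x y c) * topFst x y c + c * topSnd x y c = 0 := by
  have hmul : ((x : ℂ) - topEigenvalue x y c) * (y - topEigenvalue x y c) = c * star c := by
    rw [← starRingEnd_apply, Complex.mul_conj']
    exact_mod_cast sub_topEigenvalue_mul_sub_topEigenvalue x y c
  rw [topFst, topSnd]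
  push_cast
  linear_combination hmul / topVectorNorm x y c

theorem star_mul_topFst_add :
    star c * topFst x y c + (y - topEigenvalue x y c) * topSnd x y c = 0 := by
  rw [topFst, topSnd]
  push_cast
  ring

theorem abs_topFst_mul_le : |topFst x y c| * |x - topEigenvalue x y c| ≤ ‖c‖ := by
  have hmul : |y - topEigenvalue x y c| * |x - topEigenvalue x y c| = ‖c‖ ^ 2 := by
    rw [← abs_mul, mul_comm, sub_topEigenvalue_mul_sub_topEigenvalue,
      abs_of_nonneg (sq_nonneg _)]
  rw [topFst, abs_div, abs_of_nonneg (topVectorNorm_nonneg x y c), div_mul_eq_mul_div, hmul]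
  refine div_le_of_le_mul₀ (topVectorNorm_nonneg x y c) (norm_nonneg c) ?_
  rw [sq]
  exact mul_le_mul_of_nonneg_left (norm_le_topVectorNorm x y c) (norm_nonneg c)

variable {c}

theorem topVectorNorm_pos (hc : c ≠ 0) : 0 < topVectorNorm x y c :=
  (norm_pos_iff.mpr hc).trans_le (norm_le_topVectorNorm x y c)

theorem sq_norm_topFst_add_sq_norm_topSnd (hc : c ≠ 0) :
    ‖(topFst x y c : ℂ)‖ ^ 2 + ‖topSnd x y c‖ ^ 2 = 1 := by
  have hpos := topVectorNorm_pos x y hc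
  rw [Complex.norm_real, Real.norm_eq_abs, sq_abs, topFst, topSnd, norm_div, norm_neg, norm_star,
    Complex.norm_real, Real.norm_of_nonneg hpos.le, div_pow, div_pow, ← add_div,
    ← sq_topVectorNorm, div_self (pow_pos hpos 2).ne']

theorem topFst_ne_zero (hc : c ≠ 0) : topFst x y c ≠ 0 := by
  refine div_ne_zero (right_ne_zero_of_mul (a := x - topEigenvalue x y c) ?_)
    (topVectorNorm_pos x y hc).ne'
  rw [sub_topEigenvalue_mul_sub_topEigenvalue]
  exact pow_ne_zero 2 (norm_ne_zero_iff.mpr hc)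

end Block

section BlockMode

variable {G : Type*} [AddCommGroup G]

/-- The first column of the spectral projection of `((x, c), (c̄, y))` for its larger eigenvalue,
placed at the indices `0` and `-q`. -/
def blockMode (q : G) (x y : ℝ) (c : ℂ) : WienerAlgebra G :=
  (topFst x y c : ℂ) • twoMode q (topFst x y c : ℂ) (topSnd x y c)

theorem norm_blockMode_mul_le (q : G) (x y : ℝ) (c : ℂ) :
    ‖blockMode q x y c‖ * |x - topEigenvalue x y c| ≤ 2 * ‖c‖ := by
  have hmode : ‖twoMode q (topFst x y c : ℂ) (topSnd x y c)‖ ≤ 2 := by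
    refine (norm_twoMode_le _ _ _).trans ?_
    rw [Complex.norm_real, Real.norm_eq_abs]
    linarith [abs_topFst_le_one x y c, norm_topSnd_le_one x y c]
  rw [blockMode, norm_smul, Complex.norm_real, Real.norm_eq_abs, mul_right_comm, mul_comm (2 : ℝ)]
  exact mul_le_mul (abs_topFst_mul_le x y c) hmode (norm_nonneg _) (norm_nonneg c)

/-- The two-mode resonance carried by the larger eigenvalue of the block at `0` and `-q`. -/
def TwoModeResonance.ofBlock {p : G → ℝ} {v : WienerAlgebra G} {q : G} {ε σ : ℝ} (hε : 0 < ε)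
    (hε' : ε ≤ 1 / 1000) (hσ : |σ| ≤ ε ^ 11) (hqq : q + q ≠ 0) (hv : IsSelfAdjoint v)
    (hv0 : v 0 = 0) (hnorm : ‖v‖ ≤ ε ^ 9) (hq : ε ^ 10 ≤ ‖v q‖)
    (hsep : ∀ m, m ≠ 0 → m ≠ -q → ε ^ 6 ≤ 2 * |p m - topEigenvalue (p 0) (p (-q)) (v q)|) :
    TwoModeResonance G where
  ε := ε
  σ := σ
  lam := topEigenvalue (p 0) (p (-q)) (v q)
  q := q
  p := p
  v := v
  a := topFst (p 0) (p (-q)) (v q)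
  b := topSnd (p 0) (p (-q)) (v q)
  eps_pos := hε
  eps_le := hε'
  coupling := hσ
  add_self_ne_zero := hqq
  isSelfAdjoint := hv
  v_zero := hv0
  norm_v_le := hnorm
  unit := sq_norm_topFst_add_sq_norm_topSnd _ _ <|
    norm_pos_iff.mp ((pow_pos hε 10).trans_le hq)
  row_zero := sub_topEigenvalue_mul_topFst_add _ _ _
  row_neg := by
    have hstar : v (-q) = star (v q) := by
      conv_lhs => rw [← hv.star_eq, star_apply, neg_neg]
    rw [hstar]
    exact star_mul_topFst_add _ _ _
  two_mul_pow_le_gap := (mul_le_mul_of_nonneg_left hq zero_le_two).trans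
    (two_mul_norm_le_two_mul_topEigenvalue_sub _ _ _)
  separated := hsep

end BlockMode

theorem isSelfAdjoint_ofFinsupp {v : Idx →₀ ℂ} (hv : IsRealMeanZero v) :
    IsSelfAdjoint (ofFinsupp v) := by
  ext m
  rw [star_apply, ofFinsupp_apply, ofFinsupp_apply, hv.real, ← starRingEnd_apply, Complex.conj_conj]

theorem psi_eq_synth {v : Idx →₀ ℂ} (hv : IsRealMeanZero v) (q j : Idx) (t x : Plane) :
    psi v q j t x = synth (blockMode q (pSq j t) (pSq (j - q) t) (v q)) x := by
  have hlam : lambdaPlus v q j t = topEigenvalue (pSq j t) (pSq (j - q) t) (v q) := rfl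
  have hone : planeWave (latticeVec 0) x = 1 := by simp [planeWave_latticeVec]
  have hsum : ∑ i, ‖ePlus v q j t i‖ ^ 2
      = topVectorNorm (pSq j t) (pSq (j - q) t) (v q) ^ 2 := by
    rw [sq_topVectorNorm, Fin.sum_univ_two, ← hlam]
    simp only [ePlus, hv.real, Matrix.cons_val_zero, Matrix.cons_val_one, norm_neg,
      RCLike.norm_conj, Complex.norm_real, Real.norm_eq_abs, sq_abs]
  rw [blockMode, smul_twoMode, twoMode, map_add, BoundedContinuousFunction.add_apply, synth_single,
    synth_single, hone, latticeVec_neg, psi, projPlus, hsum]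
  simp only [Matrix.smul_apply, Matrix.vecMulVec_apply, Pi.star_apply, ePlus, hv.real,
    Matrix.cons_val_zero, Matrix.cons_val_one, smul_eq_mul, RCLike.star_def, Complex.conj_ofReal,
    topFst, topSnd, ← hlam]
  push_cast
  ring

section Quasimomentum

variable (m : Idx) (t t₀ : Plane)

theorem abs_norm_P_sub_norm_P_le : |‖P m t‖ - ‖P m t₀‖| ≤ dist t t₀ := by
  refine (abs_norm_sub_norm_le _ _).trans_eq ?_
  rw [P, P, add_sub_add_left_eq_sub, dist_eq_norm]

theorem abs_pSq_sub_le : |pSq m t - pSq m t₀| ≤ (‖P m t‖ + ‖P m t₀‖) * dist t t₀ := by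
  rw [pSq, pSq, sq_sub_sq, abs_mul, abs_of_nonneg (add_nonneg (norm_nonneg _) (norm_nonneg _))]
  exact mul_le_mul_of_nonneg_left (abs_norm_P_sub_norm_P_le m t t₀) (by positivity)

variable {m t t₀}

theorem abs_pSq_sub_le_of_norm_P_le {δ : ℝ} {j : Idx} (hk : 1 ≤ ‖P j t₀‖) (hδ : δ ≤ 1)
    (ht : dist t t₀ ≤ ‖P j t₀‖⁻¹ * δ) (hm : ‖P m t‖ ≤ ‖P j t₀‖ + 2) :
    |pSq m t - pSq m t₀| ≤ 7 * δ := by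
  have hd := dist_nonneg (x := t) (y := t₀)
  rw [inv_mul_eq_div, le_div_iff₀ (by linarith)] at ht
  have hd1 : dist t t₀ ≤ 1 := by nlinarith
  have hm₀ := (abs_le.mp (abs_norm_P_sub_norm_P_le m t t₀)).1
  calc |pSq m t - pSq m t₀| ≤ (‖P m t‖ + ‖P m t₀‖) * dist t t₀ := abs_pSq_sub_le m t t₀
    _ ≤ (2 * ‖P j t₀‖ + 5) * dist t t₀ := mul_le_mul_of_nonneg_right (by linarith) hd
    _ ≤ 7 * δ := by nlinarith

theorem pow_le_abs_pSq_sub_pSq {ε : ℝ} {j : Idx} (hε : 0 < ε) (hε' : ε ≤ 1 / 1000)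
    (hk : 1 ≤ ‖P j t₀‖) (ht : dist t t₀ ≤ ‖P j t₀‖⁻¹ * ε ^ 7)
    (hsep : 2 * ε ^ 6 < |pSq j t₀ - pSq m t₀|) : 3 / 2 * ε ^ 6 ≤ |pSq j t - pSq m t| := by
  by_contra! hclose
  have hε6 : ε ^ 6 ≤ 1 := pow_le_one₀ hε.le (by linarith)
  have hε7 : ε ^ 7 ≤ ε ^ 6 / 1000 := by
    rw [pow_succ]
    nlinarith [pow_pos hε 6]
  have hd : dist t t₀ ≤ 1 / 1000 := by
    refine ht.trans ((mul_le_of_le_one_left (pow_pos hε 7).le (inv_le_one_of_one_le₀ hk)).trans ?_)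
    linarith
  have hj : ‖P j t‖ ≤ ‖P j t₀‖ + 1 / 1000 := by
    linarith [(abs_le.mp (abs_norm_P_sub_norm_P_le j t t₀)).2]
  have hm : ‖P m t‖ ≤ ‖P j t₀‖ + 2 := by
    refine abs_le_of_sq_le_sq' ?_ (by linarith) |>.2
    have hpow : ‖P j t‖ ^ 2 ≤ (‖P j t₀‖ + 1 / 1000) ^ 2 := by gcongr
    rw [pSq, pSq] at hclose
    nlinarith [(abs_lt.mp hclose).1]
  have hj₀ := abs_pSq_sub_le_of_norm_P_le hk (by linarith) ht (m := j) (by linarith)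
  have hm₀ := abs_pSq_sub_le_of_norm_P_le hk (by linarith) ht hm
  rw [abs_sub_comm] at hj₀
  linarith [abs_sub_le (pSq j t₀) (pSq j t) (pSq m t₀), abs_sub_le (pSq j t) (pSq m t) (pSq m t₀),
    pow_pos hε 6]

end Quasimomentum

theorem planeWave_mul_synth_ne_zero {A : ℂ} (hA : A ≠ 0) (j : Idx) (t : Plane)
    {g : WienerAlgebra Idx} (hg : g ≠ 0) :
    (fun x => A * planeWave (P j t) x * synth g x) ≠ 0 := fun hu => by
  refine hg (synth_injective (BoundedContinuousFunction.ext fun x => ?_))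
  have hwave : planeWave (P j t) x ≠ 0 := norm_ne_zero_iff.mp (by rw [norm_planeWave]; norm_num)
  rw [map_zero]
  exact (mul_eq_zero.mp (congrFun hu x)).resolve_left (mul_ne_zero hA hwave)

section Existence

variable {ε σ : ℝ} {A : ℂ} {v : WienerAlgebra Idx} {q j : Idx} {t t₀ : Plane}

theorem exists_isSolution_of_separated (hε : 0 < ε) (hε' : ε ≤ 1 / 1000) (hv : IsSelfAdjoint v)
    (hv0 : v 0 = 0) (hnorm : ‖v‖ ≤ ε ^ 9) (hq : ε ^ 10 ≤ ‖v q‖) (hσ : |σ| * ‖A‖ ^ 2 ≤ ε ^ 11)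
    (hsep : ∀ m, m ≠ j → m ≠ j - q →
      ε ^ 6 ≤ 2 * |pSq m t - topEigenvalue (pSq j t) (pSq (j - q) t) (v q)|) :
    ∃ (g : WienerAlgebra Idx) (lam : ℝ),
      IsSolution (synth v) σ lam (fun x => A * planeWave (P j t) x * synth g x) ∧ g ≠ 0 ∧
      ‖g - blockMode q (pSq j t) (pSq (j - q) t) (v q)‖ ≤ ε ∧
      |lam - topEigenvalue (pSq j t) (pSq (j - q) t) (v q)| ≤ 9 * ε ^ 11 := by
  set a := topFst (pSq j t) (pSq (j - q) t) (v q)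
  have hvq : v q ≠ 0 := norm_pos_iff.mp ((pow_pos hε 10).trans_le hq)
  have hqq : q + q ≠ 0 := fun h => hvq (by rw [self_eq_neg.mp (eq_neg_of_add_eq_zero_left h), hv0])
  have ha : ‖(a : ℂ)‖ ≤ 1 := by
    rw [Complex.norm_real]
    exact abs_topFst_le_one _ _ _
  have hσa : |σ * ‖A * a‖ ^ 2| ≤ ε ^ 11 := by
    rw [abs_mul, abs_of_nonneg (sq_nonneg ‖A * a‖), norm_mul]
    refine le_trans ?_ hσ
    gcongr
    exact mul_le_of_le_one_right (norm_nonneg A) ha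
  have hfar (m : Idx) (hm : m ≠ 0) (hmq : m ≠ -q) :
      ε ^ 6 ≤ 2 * |pSq (j + m) t - topEigenvalue (pSq (j + 0) t) (pSq (j + -q) t) (v q)| := by
    rw [add_zero, ← sub_eq_add_neg]
    exact hsep (j + m) (by simpa using hm) (by simpa [sub_eq_add_neg] using hmq)
  obtain ⟨f, lam, hf, hf0, hclose, hlam⟩ := (TwoModeResonance.ofBlock
    (p := fun m => pSq (j + m) t) hε hε' hσa hqq hv hv0 hnorm hq hfar).exists_solvesModeSystem
  simp only [TwoModeResonance.ofBlock, add_zero, ← sub_eq_add_neg] at hf hclose hlam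
  refine ⟨(a : ℂ) • f, lam, ?_, ?_, ?_, hlam⟩
  · convert hf.isSolution using 2 with x
    rw [map_smul, BoundedContinuousFunction.smul_apply, smul_eq_mul]
    ring
  · exact smul_ne_zero (Complex.ofReal_ne_zero.mpr (topFst_ne_zero _ _ hvq)) hf0
  · rw [blockMode, ← smul_sub, norm_smul]
    exact (mul_le_of_le_one_left (norm_nonneg _) ha).trans hclose

theorem norm_blockMode_le_of_far {x y : ℝ} {c : ℂ} (hε : 0 < ε) (hε' : ε ≤ 1 / 1000)
    (hc : ‖c‖ ≤ ε ^ 9) (hfar : ε ^ 6 ≤ |x - topEigenvalue x y c|) (q : Idx) :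
    ‖blockMode q x y c‖ ≤ ε := by
  have h : ε ^ 6 * ‖blockMode q x y c‖ ≤ ε ^ 6 * ε :=
    calc ε ^ 6 * ‖blockMode q x y c‖
        ≤ ‖blockMode q x y c‖ * |x - topEigenvalue x y c| := by
          rw [mul_comm]
          gcongr
      _ ≤ 2 * ε ^ 9 := (norm_blockMode_mul_le q x y c).trans (by gcongr)
      _ = ε ^ 6 * ε * (2 * ε ^ 2) := by ring
      _ ≤ ε ^ 6 * ε := mul_le_of_le_one_right (by positivity) (by nlinarith)
  exact le_of_mul_le_mul_left h (pow_pos hε 6)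

theorem exists_isSolution (hε : 0 < ε) (hε' : ε ≤ 1 / 1000) (hv : IsSelfAdjoint v)
    (hv0 : v 0 = 0) (hnorm : ‖v‖ ≤ ε ^ 9) (hq : ε ^ 10 ≤ ‖v q‖) (hσ : |σ| * ‖A‖ ^ 2 ≤ ε ^ 11)
    (hk : 1 ≤ ‖P j t₀‖) (hsep : ∀ m, m ≠ j → m ≠ j - q → 2 * ε ^ 6 < |pSq j t₀ - pSq m t₀|)
    (ht : dist t t₀ ≤ ‖P j t₀‖⁻¹ * ε ^ 7) :
    ∃ (g : WienerAlgebra Idx) (lam : ℝ),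
      IsSolution (synth v) σ lam (fun x => A * planeWave (P j t) x * synth g x) ∧
      ‖g - blockMode q (pSq j t) (pSq (j - q) t) (v q)‖ ≤ ε ∧
      |lam - topEigenvalue (pSq j t) (pSq (j - q) t) (v q)| ≤ 9 * ε ^ 11 ∧
      ((∀ m, m ≠ j → m ≠ j - q →
        ε ^ 6 ≤ 2 * |pSq m t - topEigenvalue (pSq j t) (pSq (j - q) t) (v q)|) → g ≠ 0) := by
  by_cases hfar : ∀ m, m ≠ j → m ≠ j - q →
      ε ^ 6 ≤ 2 * |pSq m t - topEigenvalue (pSq j t) (pSq (j - q) t) (v q)|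
  · obtain ⟨g, lam, hsol, hg0, hg, hlam⟩ :=
      exists_isSolution_of_separated hε hε' hv hv0 hnorm hq hσ hfar
    exact ⟨g, lam, hsol, hg, hlam, fun _ => hg0⟩
  -- A free eigenvalue off the pair is near `lam⁺`, so `p_j²(t)` is not. The leading term is then
  -- small, and the zero solution does.
  refine ⟨0, topEigenvalue (pSq j t) (pSq (j - q) t) (v q), ?_, ?_, ?_, fun h => absurd h hfar⟩
  · exact SolvesModeSystem.isSolution (f := 0) fun m => by simp [cubic]
  · push Not at hfar
    obtain ⟨m, hmj, hmq, hnear⟩ := hfar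
    rw [zero_sub, norm_neg]
    refine norm_blockMode_le_of_far hε hε' ((norm_apply_le v q).trans hnorm) ?_ q
    have hgap := pow_le_abs_pSq_sub_pSq hε hε' hk ht (hsep m hmj hmq)
    have htri := abs_sub_le (pSq j t) (topEigenvalue (pSq j t) (pSq (j - q) t) (v q)) (pSq m t)
    rw [abs_sub_comm (topEigenvalue _ _ _)] at htri
    linarith
  · rw [sub_self, abs_zero]
    positivity

end Existence

end GrossPitaevskii

end

theorem mainTheorem2_general {ε σ : ℝ} {A : ℂ} {v : WienerAlgebra Idx} {q j : Idx} {t t₀ : Plane}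
    (hε : 0 < ε) (hε' : ε ≤ 1 / 1000) (hv : IsSelfAdjoint v) (hv0 : v 0 = 0) (hnorm : ‖v‖ ≤ ε ^ 9)
    (hq : ε ^ 10 ≤ ‖v q‖) (hσ : |σ| * ‖A‖ ^ 2 ≤ ε ^ 11) (hk : 1 ≤ ‖P j t₀‖)
    (hsep : ∀ m, m ≠ j → m ≠ j - q → 2 * ε ^ 6 < |pSq j t₀ - pSq m t₀|)
    (ht : dist t t₀ ≤ ‖P j t₀‖⁻¹ * ε ^ 7) :
    ∃ (u w : Plane → ℂ) (lam : ℝ),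
      IsSolution (synth v) σ lam u ∧
      IsQuasiPeriodic t u ∧
      (∀ x, u x = A * planeWave (P j t) x *
        (synth (blockMode q (pSq j t) (pSq (j - q) t) (v q)) x + w x)) ∧
      |lam - topEigenvalue (pSq j t) (pSq (j - q) t) (v q)| ≤ 9 * ε ^ 11 ∧
      Continuous w ∧ IsPeriodic w ∧ starNorm w ≤ ENNReal.ofReal ε ∧
      (A ≠ 0 → (∀ m, m ≠ j → m ≠ j - q →
        ε ^ 6 ≤ 2 * |pSq m t - topEigenvalue (pSq j t) (pSq (j - q) t) (v q)|) → u ≠ 0) := by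
  obtain ⟨g, lam, hsol, hg, hlam, hne⟩ :=
    exists_isSolution hε hε' hv hv0 hnorm hq hσ hk hsep ht
  refine ⟨_, synth (g - blockMode q (pSq j t) (pSq (j - q) t) (v q)), lam, hsol,
    isQuasiPeriodic_planeWave_mul (hsol.1.differentiable two_ne_zero) (isPeriodic_synth g),
    fun x => ?_, hlam, map_continuous _, isPeriodic_synth _, ?_,
    fun hA hfar => planeWave_mul_synth_ne_zero hA j t (hne hfar)⟩
  · rw [map_sub, BoundedContinuousFunction.sub_apply, add_sub_cancel]
  · rw [starNorm_synth]
    exact ENNReal.ofReal_le_ofReal hg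

theorem mainTheorem2 :
    ∃ ε₀ : ℝ, 0 < ε₀ ∧ ∃ C : ℝ, 0 < C ∧
      ∀ ε : ℝ, 0 < ε → ε < ε₀ →
      ∀ v : Idx →₀ ℂ, IsRealMeanZero v → starNorm (trigPoly v) < ENNReal.ofReal (ε ^ 9) →
      ∃ k₁ : ℝ, ∀ k : ℝ, k₁ < k →
      ∀ q : Idx, ε ^ 10 < ‖v q‖ →
      ∀ (σ : ℝ) (A : ℂ), |σ| * ‖A‖ ^ 2 < ε ^ 11 →
      ∀ t₀ ∈ resonantSet q k ε, ∀ j : Idx, IsResonantIndex q k ε t₀ j →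
      ∀ t ∈ dualCell, dist t t₀ < k⁻¹ * ε ^ 7 →
      ∃ (u w : Plane → ℂ) (lam : ℝ),
        IsSolution (trigPoly v) σ lam u ∧
        IsQuasiPeriodic t u ∧
        (∀ x, u x = A * planeWave (P j t) x * (psi v q j t x + w x)) ∧
        |lam - lambdaPlus v q j t| ≤ C * ε ^ 11 ∧
        Continuous w ∧ IsPeriodic w ∧ starNorm w ≤ ENNReal.ofReal ε ∧
        (A ≠ 0 → (∀ m, m ≠ j → m ≠ j - q → ε ^ 6 ≤ 2 * |pSq m t - lambdaPlus v q j t|) →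
          u ≠ 0) := by
  refine ⟨1 / 1000, by norm_num, 9, by norm_num, fun ε hε hε' v hv hV => ⟨1, ?_⟩⟩
  intro k hk q hq σ A hσ t₀ _ j hj t _ ht
  rw [← hj.on_circle] at hk ht
  rw [← synth_ofFinsupp, starNorm_synth, ENNReal.ofReal_lt_ofReal_iff (pow_pos hε 9)] at hV
  simp only [← synth_ofFinsupp, psi_eq_synth hv]
  exact mainTheorem2_general hε hε'.le (isSelfAdjoint_ofFinsupp hv) hv.mean_zero hV.le hq.le hσ.le
    hk.le hj.separated ht.le
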